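/- Let $R_0$ be a commutative Noetherian domain, let $S=R_0[U_1,\dots,U_s]$ be a polynomial ring graded by giving the elements of $R_0$ degree $0$ and the indeterminates $U_1,\dots,U_s$ positive integer degrees $d_1,\dots,d_s$, let $I\subseteq S$ be a homogeneous ideal, and let $R=S/I$. Let $R_+$ be the ideal of $R$ generated by the homogeneous elements of positive degree, and let $\mathfrak c(I)$ be the content of $I$, i.e. the ideal of $R_0$ generated by all the coefficients of all the elements of $I$. Then the $R$-module $H^s_{R_+}(R)$, the $s$-th local cohomology module of $R$ with respect to $R_+$, has only finitely many minimal associated primes (associated primes that are minimal with respect to inclusion among all the associated primes), and these are exactly the minimal primes of the ideal $\mathfrak c(I)R+R_+$. Consequently the support of $H^s_{R_+}(R)$ is $$\operatorname{Supp}_R H^s_{R_+}(R)=V\bigl(\mathfrak c(I)R+R_+\bigr)=\{\mathfrak p\in\operatorname{Spec} R:\ \mathfrak p\supseteq \mathfrak c(I)R+R_+\}.$$ -/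

import Mathlib

attribute [local instance] MvPolynomial.weightedGradedAlgebra

universe u

namespace TopLocalCohomology

noncomputable section

/-- The content `𝔠(f)` of a polynomial: the ideal of `R₀` generated by its coefficients. -/
def polyContent {R₀ : Type u} [CommRing R₀] {s : ℕ} (f : MvPolynomial (Fin s) R₀) : Ideal R₀ :=
  Ideal.span (Set.range fun m : Fin s →₀ ℕ => MvPolynomial.coeff m f)

/-- The content `𝔠(J)` of an ideal of `R₀[U₁, …, Uₛ]`: the ideal of `R₀` generated by the
contents of all elements of `J`. -/
def content {R₀ : Type u} [CommRing R₀] {s : ℕ} (J : Ideal (MvPolynomial (Fin s) R₀)) :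
    Ideal R₀ :=
  ⨆ f ∈ J, polyContent f

/-- The ideal `R₊` of `R = R₀[U₁, …, Uₛ] / I`, where `Uᵢ` has degree `d i`: it is generated by
the homogeneous elements of positive degree, that is, by the classes of the weighted homogeneous
polynomials of positive degree. -/
def irrelevantIdeal {R₀ : Type u} [CommRing R₀] {s : ℕ} (d : Fin s → ℕ)
    (I : Ideal (MvPolynomial (Fin s) R₀)) : Ideal (MvPolynomial (Fin s) R₀ ⧸ I) :=
  Ideal.span {x | ∃ n : ℕ, 0 < n ∧ ∃ f : MvPolynomial (Fin s) R₀,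
    MvPolynomial.IsWeightedHomogeneous d f n ∧ Ideal.Quotient.mk I f = x}

/-- The `R`-module `H^s_{R₊}(R)`, where `R = R₀[U₁, …, Uₛ] / I` and `s` is the number of
variables. -/
abbrev topLocalCohomology {R₀ : Type u} [CommRing R₀] {s : ℕ} (d : Fin s → ℕ)
    (I : Ideal (MvPolynomial (Fin s) R₀)) : ModuleCat.{u} (MvPolynomial (Fin s) R₀ ⧸ I) :=
  (localCohomology (irrelevantIdeal d I) s).obj
    (ModuleCat.of (MvPolynomial (Fin s) R₀ ⧸ I) (MvPolynomial (Fin s) R₀ ⧸ I))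

/-- The ideal `𝔠(I)R + R₊` of `R = R₀[U₁, …, Uₛ] / I`. -/
def contentPlusIrrelevant {R₀ : Type u} [CommRing R₀] {s : ℕ} (d : Fin s → ℕ)
    (I : Ideal (MvPolynomial (Fin s) R₀)) : Ideal (MvPolynomial (Fin s) R₀ ⧸ I) :=
  (content I).map (algebraMap R₀ (MvPolynomial (Fin s) R₀ ⧸ I)) ⊔ irrelevantIdeal d I

/-- The minimal associated primes of a module: the associated primes that are minimal under
inclusion among all associated primes. -/
def minimalAssociatedPrimes (R : Type u) [CommRing R] (M : Type u) [AddCommGroup M] [Module R M] :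
    Set (Ideal R) :=
  {p | Minimal (fun q => q ∈ associatedPrimes R M) p}

end

end TopLocalCohomology

/-! Write u_i for the class of U_i. Since all degrees are positive, R_+ = (u_1, …, u_s), and
H^s_{R_+}(R) is the direct limit of the quotients R/(u_1^t, …, u_s^t) along multiplication by u =
u_1⋯u_s. Its elements are fractions x/u^t, and x/u^t = 0 exactly when u^k x ∈ (u_1^{t+k}, …,
u_s^{t+k}) for some k (`isTopCech_localCohomology`). The support is read off from this criterion.
The statements on associated primes follow, because over a Noetherian ring a module with support
V(a) has the minimal primes of a as its minimal associated primes (`minimalAssociatedPrimes_eq`).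

The support contains V(𝔠(I)R + R_+) because the annihilator of 1/u lies in 𝔠(I)R + R_+. If F/u = 0,
then U^k F - ∑ U_i^{1+k} G_i ∈ I, where U = U_1⋯U_s; its coefficient at (k, …, k) is the constant
term of F, which therefore lies in 𝔠(I) (`mem_contentPlusIrrelevant`).

For the other inclusion, u_i^t kills x/u^t, so a prime P of the support contains R_+. Suppose p = P
∩ R₀ does not contain 𝔠(I). Then I contains a homogeneous f with a coefficient outside p.
Multiplication by f, shifted by the leading exponent of f mod p, has on a suitable graded piece of
R₀[U]/(U_1^N, …, U_s^N) a square matrix that is triangular mod p with the leading coefficient on its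
diagonal. Its determinant r is outside p and, by Cramer's rule, multiplies the monomials of that
piece into (f, U_1^N, …, U_s^N) (`exists_smul_monomial_mem`). As f vanishes in R, every fraction is
killed by an element outside p, a contradiction.

The direct limit description is proved by adding one generator at a time, passing from N to N_a/N
(`LimExt.top_of_isPowTorsion`). This needs long exact sequences and the vanishing of higher local
cohomology on torsion modules. The long exact sequences come from `Abelian.Ext`, whereas
`localCohomology` is built from derived functors, so the two kinds of `Ext` are first identified. -/

namespace TopLocalCohomology

noncomputable section

open CategoryTheory Opposite Limits Abelian

/-! ### Identification of the two definitions of `Ext` -/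

section Comparison

variable {R : Type u} [CommRing R]

/-- The functor `Hom(-, Y)` whose left derived functors define `Ext`. -/
abbrev homInto (Y : ModuleCat.{u} R) : ModuleCat.{u} R ⥤ (ModuleCat.{u} R)ᵒᵖ :=
  ((linearYoneda R (ModuleCat.{u} R)).obj Y).rightOp

variable {X Y : ModuleCat.{u} R} (P : ProjectiveResolution X) (n : ℕ)

/-- The complex `Hom(P, Y)`, as a chain complex in the opposite category. -/
abbrev homComplex (Y : ModuleCat.{u} R) : ChainComplex (ModuleCat.{u} R)ᵒᵖ ℕ :=
  ((homInto Y).mapHomologicalComplex _).obj P.complex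

/-- The module of cocycles in `Hom(P, Y)`. -/
abbrev homCocycles (Y : ModuleCat.{u} R) : ModuleCat.{u} R :=
  ((homComplex P Y).opcycles n).unop

/-- The inclusion of the cocycles. -/
def homCocyclesι (Y : ModuleCat.{u} R) :
    homCocycles P n Y →ₗ[R] (P.complex.X n ⟶ Y) :=
  ((homComplex P Y).pOpcycles n).unop.hom

lemma homCocyclesι_injective : Function.Injective (homCocyclesι P n Y) :=
  (ModuleCat.mono_iff_injective ((homComplex P Y).pOpcycles n).unop).1 inferInstance

lemma d_comp_homCocyclesι (m : ℕ) (x : homCocycles P n Y) :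
    P.complex.d m n ≫ homCocyclesι P n Y x = 0 := by
  have h := (homComplex P Y).d_pOpcycles m n
  have h2 := congrArg (fun f => f.unop.hom x) h
  exact h2

/-- Opcycles form a cokernel in the opposite category, hence a kernel after `unop`. -/
lemma exists_homCocycles (f : P.complex.X n ⟶ Y) (hf : P.complex.d (n + 1) n ≫ f = 0) :
    ∃ x, homCocyclesι P n Y x = f := by
  have hex : (ShortComplex.mk _ _ ((homComplex P Y).d_pOpcycles (n + 1) n)).Exact :=
    ShortComplex.exact_of_g_is_cokernel _
      ((homComplex P Y).opcyclesIsCokernel (n + 1) n (by simp))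
  have hex2 := hex.unop
  rw [ShortComplex.moduleCat_exact_iff] at hex2
  exact hex2 f hf

/-- The left derived functors of `Hom(-, Y)` are computed by `Hom(P, Y)`. -/
def leftDerivedIso (Y : ModuleCat.{u} R) :
    ((homInto Y).leftDerived n).obj X ≅ (homComplex P Y).homology n :=
  P.isoLeftDerivedObj (homInto Y) n

lemma leftDerivedIso_naturality {X' : ModuleCat.{u} R} {P' : ProjectiveResolution X'}
    {g : X' ⟶ X} (φ : ProjectiveResolution.Hom P' P g) :
    ((homInto Y).leftDerived n).map g ≫ (leftDerivedIso P n Y).hom =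
      (leftDerivedIso P' n Y).hom ≫ HomologicalComplex.homologyMap
        (((homInto Y).mapHomologicalComplex (ComplexShape.down ℕ)).map φ.hom) n :=
  ProjectiveResolution.isoLeftDerivedObj_hom_naturality g P' P φ.hom
    (by simpa using φ.hom_f_zero_comp_π_f_zero) (homInto Y) n

/-- The class in `Ext` (in the derived functor sense) of a cocycle. -/
def derivedExtMk (Y : ModuleCat.{u} R) :
    homCocycles P n Y →ₗ[R] ((Ext R (ModuleCat.{u} R) n).obj (op X)).obj Y :=
  ((leftDerivedIso P n Y).hom ≫ (homComplex P Y).homologyι n).unop.hom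

lemma derivedExtMk_surjective : Function.Surjective (derivedExtMk P n Y) :=
  (ModuleCat.epi_iff_surjective
    ((leftDerivedIso P n Y).hom ≫ (homComplex P Y).homologyι n).unop).1
      inferInstance

lemma homologyι_unop_eq_zero {x : homCocycles P n Y} (h : derivedExtMk P n Y x = 0) :
    ((homComplex P Y).homologyι n).unop.hom x = 0 := by
  have hi : Function.Injective (leftDerivedIso P n Y).hom.unop.hom :=
    (ModuleCat.mono_iff_injective (leftDerivedIso P n Y).hom.unop).1 inferInstance
  exact hi (h.trans (map_zero _).symm)

lemma derivedExtMk_zero_eq_zero_iff (x : homCocycles P 0 Y) :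
    derivedExtMk P 0 Y x = 0 ↔ homCocyclesι P 0 Y x = 0 := by
  rw [map_eq_zero_iff _ (homCocyclesι_injective P 0)]
  refine ⟨fun h => ?_, fun h => by rw [h, map_zero]⟩
  have h1 := homologyι_unop_eq_zero P 0 h
  -- There are no coboundaries in degree 0, so `homologyι` is invertible there.
  have hi : Function.Injective ((homComplex P Y).homologyι 0).unop.hom :=
    (ModuleCat.mono_iff_injective ((homComplex P Y).homologyι 0).unop).1 inferInstance
  exact hi (h1.trans (map_zero _).symm)

lemma derivedExtMk_succ_eq_zero_iff (x : homCocycles P (n + 1) Y) :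
    derivedExtMk P (n + 1) Y x = 0 ↔
      ∃ g : P.complex.X n ⟶ Y, P.complex.d (n + 1) n ≫ g = homCocyclesι P (n + 1) Y x := by
  have hex : (ShortComplex.mk _ _
      ((homComplex P Y).homologyι_comp_fromOpcycles (n + 1) n)).Exact :=
    ShortComplex.exact_of_f_is_kernel _
      ((homComplex P Y).homologyIsKernel (n + 1) n (by simp))
  have hex2 := hex.unop
  rw [ShortComplex.moduleCat_exact_iff] at hex2
  have key : ∀ g : P.complex.X n ⟶ Y, homCocyclesι P (n + 1) Y
      (((homComplex P Y).fromOpcycles (n + 1) n).unop.hom g) = P.complex.d (n + 1) n ≫ g :=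
    fun g => congrArg (fun f => f.unop.hom g) ((homComplex P Y).p_fromOpcycles (n + 1) n)
  constructor
  · intro h
    obtain ⟨g, hg⟩ := hex2 x (homologyι_unop_eq_zero P (n + 1) h)
    exact ⟨g, (key g).symm.trans (congrArg _ hg)⟩
  · rintro ⟨g, hg⟩
    rw [← key] at hg
    rw [← homCocyclesι_injective P (n + 1) hg]
    have := congrArg (fun f => f.unop.hom g)
      ((homComplex P Y).homologyι_comp_fromOpcycles (n + 1) n)
    change (leftDerivedIso P (n + 1) Y).hom.unop.hom _ = 0
    rw [← map_zero (leftDerivedIso P (n + 1) Y).hom.unop.hom]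
    exact congrArg _ this

lemma derivedExtMk_naturality {X' : ModuleCat.{u} R} {P' : ProjectiveResolution X'} {g : X' ⟶ X}
    (φ : ProjectiveResolution.Hom P' P g) (x : homCocycles P n Y) (x' : homCocycles P' n Y)
    (hx : homCocyclesι P' n Y x' = φ.hom.f n ≫ homCocyclesι P n Y x) :
    (((Ext R (ModuleCat.{u} R) n).map g.op).app Y).hom (derivedExtMk P n Y x) =
      derivedExtMk P' n Y x' := by
  let ψ := ((homInto Y).mapHomologicalComplex (ComplexShape.down ℕ)).map φ.hom
  have h1 : (HomologicalComplex.opcyclesMap ψ n).unop.hom x = x' := by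
    apply homCocyclesι_injective P' n
    rw [hx]
    exact congrArg (fun f => f.unop.hom x) (HomologicalComplex.p_opcyclesMap ψ n)
  have h2 : ((homInto Y).leftDerived n).map g ≫
      ((leftDerivedIso P n Y).hom ≫ (homComplex P Y).homologyι n) =
      ((leftDerivedIso P' n Y).hom ≫ (homComplex P' Y).homologyι n) ≫
        HomologicalComplex.opcyclesMap ψ n := by
    rw [← Category.assoc, leftDerivedIso_naturality P n φ, Category.assoc, Category.assoc]
    congr 1
    exact HomologicalComplex.homologyι_naturality ψ n
  have h3 := congrArg (fun f => f.unop.hom x) h2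
  rw [← h1]
  exact h3

/-- The class in `Ext` (in the derived category sense) of a cocycle. -/
def extMk (Y : ModuleCat.{u} R) : homCocycles P n Y →ₗ[R] Abelian.Ext X Y n where
  toFun x := P.extMk (homCocyclesι P n Y x) (n + 1) rfl (d_comp_homCocyclesι P n _ x)
  map_add' x y := by
    rw [P.add_extMk]
    congr 1
    exact map_add _ _ _
  map_smul' r x := by
    rw [RingHom.id_apply, Abelian.Ext.smul_eq_comp_mk₀, P.extMk_comp_mk₀]
    congr 1
    rw [map_smul]
    simp

lemma extMk_surjective : Function.Surjective (extMk P n Y) := fun α => by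
  obtain ⟨f, hf, rfl⟩ := P.extMk_surjective α (n + 1) rfl
  obtain ⟨x, rfl⟩ := exists_homCocycles P n f hf
  exact ⟨x, rfl⟩

lemma extMk_zero_eq_zero_iff (x : homCocycles P 0 Y) :
    extMk P 0 Y x = 0 ↔ homCocyclesι P 0 Y x = 0 := by
  refine ⟨fun h => ?_, fun h => ?_⟩
  · have h' : P.extMk (homCocyclesι P 0 Y x) 1 rfl (d_comp_homCocyclesι P 0 _ x) = 0 := h
    rw [← P.extEquivCohomologyClass.apply_eq_iff_eq,
      ProjectiveResolution.extEquivCohomologyClass_extMk,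
      ProjectiveResolution.extEquivCohomologyClass_zero,
      CochainComplex.HomComplex.CohomologyClass.mk_eq_zero_iff,
      CochainComplex.HomComplex.Cocycle.toSingleMk_mem_coboundaries_iff _ _ _ _ _ 1 (by lia)] at h'
    obtain ⟨g, hg⟩ := h'
    -- As a cochain complex the resolution sits in nonpositive degrees, so the only possible
    -- coboundary is zero.
    have hz : IsZero (P.cochainComplex.X 1) :=
      CochainComplex.isZero_of_isStrictlyLE _ 0 1 (by lia)
    rw [hz.eq_of_src g 0, comp_zero] at hg
    rw [← cancel_epi (P.cochainComplexXIso (-(0 : ℕ)) 0 rfl).hom]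
    simpa using hg.symm
  · rw [map_eq_zero_iff _ (homCocyclesι_injective P 0)] at h
    rw [h, map_zero]

/-- Both `Ext` modules are quotients of the same module of cocycles; in each, the classes that
vanish are the coboundaries. -/
lemma ker_extMk : LinearMap.ker (extMk P n Y) = LinearMap.ker (derivedExtMk P n Y) := by
  ext x
  rw [LinearMap.mem_ker, LinearMap.mem_ker]
  cases n with
  | zero => rw [extMk_zero_eq_zero_iff, derivedExtMk_zero_eq_zero_iff]
  | succ n =>
    rw [derivedExtMk_succ_eq_zero_iff]
    exact P.extMk_eq_zero_iff _ _ rfl (d_comp_homCocyclesι P (n + 1) _ x) n rfl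

/-- The two definitions of `Ext` agree. -/
def extEquivDerivedExt (X Y : ModuleCat.{u} R) (n : ℕ) :
    Abelian.Ext X Y n ≃ₗ[R] ((Ext R (ModuleCat.{u} R) n).obj (op X)).obj Y :=
  ((extMk (projectiveResolution X) n Y).quotKerEquivOfSurjective (extMk_surjective _ n)).symm ≪≫ₗ
    Submodule.quotEquivOfEq _ _ (ker_extMk _ n) ≪≫ₗ
    (derivedExtMk (projectiveResolution X) n Y).quotKerEquivOfSurjective
      (derivedExtMk_surjective _ n)

lemma extEquivDerivedExt_extMk (x : homCocycles (projectiveResolution X) n Y) :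
    extEquivDerivedExt X Y n (extMk _ n Y x) = derivedExtMk _ n Y x := by
  have : extMk (projectiveResolution X) n Y x =
    (extMk (projectiveResolution X) n Y).quotKerEquivOfSurjective (extMk_surjective _ n)
      (Submodule.Quotient.mk x) := rfl
  rw [this]
  simp only [extEquivDerivedExt, LinearEquiv.trans_apply, LinearEquiv.symm_apply_apply]
  rfl

/-- Needed to match the transition maps R/J^{t'} → R/J^t. A lift of `g` to projective resolutions
computes both sides on cocycles. -/
lemma extEquivDerivedExt_naturality {X' : ModuleCat.{u} R} (g : X' ⟶ X) (e : Abelian.Ext X Y n) :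
    extEquivDerivedExt X' Y n ((Abelian.Ext.mk₀ g).comp e (zero_add n)) =
      (((Ext R (ModuleCat.{u} R) n).map g.op).app Y).hom (extEquivDerivedExt X Y n e) := by
  obtain ⟨x, rfl⟩ := extMk_surjective (projectiveResolution X) n e
  let φ : ProjectiveResolution.Hom (projectiveResolution X') (projectiveResolution X) g :=
    ⟨ProjectiveResolution.lift g _ _, by
      simpa using ProjectiveResolution.lift_commutes_zero g _ _⟩
  have h1 := ProjectiveResolution.mk₀_comp_extMk (homCocyclesι _ n Y x) (n + 1) rfl
    (d_comp_homCocyclesι _ n _ x) φ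
  obtain ⟨x', hx'⟩ := exists_homCocycles (projectiveResolution X') n
    (φ.hom.f n ≫ homCocyclesι _ n Y x) (by
      rw [← φ.hom.comm_assoc, d_comp_homCocyclesι, comp_zero])
  have h2 : (Abelian.Ext.mk₀ g).comp (extMk _ n Y x) (zero_add n) = extMk _ n Y x' := by
    refine h1.trans ?_
    change _ = ProjectiveResolution.extMk _ _ (n + 1) rfl (d_comp_homCocyclesι _ n _ x')
    congr 1
    exact hx'.symm
  rw [h2, extEquivDerivedExt_extMk, extEquivDerivedExt_extMk]
  exact (derivedExtMk_naturality _ n φ x x' hx').symm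

end Comparison

end

end TopLocalCohomology

namespace TopLocalCohomology

noncomputable section

open CategoryTheory Opposite Limits Abelian

/-! ### Local cohomology as a direct limit of `Ext` modules -/

section LimExt

variable {R : Type u} [CommRing R] (J : Ideal R)

/-- The `R`-module `R / J ^ t`. -/
abbrev quotPow (t : ℕ) : ModuleCat.{u} R := ModuleCat.of R (R ⧸ J ^ t)

/-- The projection `R / J ^ t' → R / J ^ t` for `t ≤ t'`. -/
def quotPowMap {t t' : ℕ} (h : t ≤ t') : quotPow J t' ⟶ quotPow J t :=
  ModuleCat.ofHom (Submodule.mapQ _ _ LinearMap.id (Ideal.pow_le_pow_right h))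

lemma quotPowMap_self (t : ℕ) : quotPowMap J (le_refl t) = 𝟙 _ := by
  ext; rfl

lemma quotPowMap_comp {a b c : ℕ} (h : a ≤ b) (h' : b ≤ c) :
    quotPowMap J h' ≫ quotPowMap J h = quotPowMap J (h.trans h') := by
  ext; rfl

variable (i : ℕ) (M : ModuleCat.{u} R)

/-- The transition maps of the system `Ext^i(R / J ^ t, M)`. -/
def extTransition (t t' : ℕ) (h : t ≤ t') :
    Abelian.Ext (quotPow J t) M i →ₗ[R] Abelian.Ext (quotPow J t') M i :=
  Abelian.Ext.precompOfLinear (Abelian.Ext.mk₀ (quotPowMap J h)) R M (zero_add i)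

lemma extTransition_apply {t t' : ℕ} (h : t ≤ t') (e : Abelian.Ext (quotPow J t) M i) :
    extTransition J i M t t' h e = (Abelian.Ext.mk₀ (quotPowMap J h)).comp e (zero_add i) := rfl

instance : DirectedSystem (fun t => Abelian.Ext (quotPow J t) M i)
    (fun t t' h => extTransition J i M t t' h) where
  map_self t x := by
    rw [extTransition_apply, quotPowMap_self, Abelian.Ext.mk₀_id_comp]
  map_map a b c h h' x := by
    rw [extTransition_apply, extTransition_apply, extTransition_apply,
      Abelian.Ext.mk₀_comp_mk₀_assoc, quotPowMap_comp]

/-- The direct limit of the modules `Ext^i(R / J ^ t, M)`. -/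
def LimExt : Type u :=
  Module.DirectLimit (fun t => Abelian.Ext (quotPow J t) M i) (extTransition J i M)

instance : AddCommGroup (LimExt J i M) :=
  inferInstanceAs (AddCommGroup (Module.DirectLimit _ _))

instance : Module R (LimExt J i M) :=
  inferInstanceAs (Module R (Module.DirectLimit _ _))

variable {M i}

/-- The map from `Ext^i(R / J ^ t, M)` to the direct limit. -/
def LimExt.of (t : ℕ) : Abelian.Ext (quotPow J t) M i →ₗ[R] LimExt J i M :=
  Module.DirectLimit.of R ℕ (fun t => Abelian.Ext (quotPow J t) M i) (extTransition J i M) t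

/-- The universal property of the direct limit. -/
def LimExt.lift {N : Type*} [AddCommGroup N] [Module R N]
    (g : ∀ t, Abelian.Ext (quotPow J t) M i →ₗ[R] N)
    (hg : ∀ t t' (h : t ≤ t') e, g t' (extTransition J i M t t' h e) = g t e) :
    LimExt J i M →ₗ[R] N :=
  Module.DirectLimit.lift R ℕ _ _ g hg

lemma LimExt.lift_of {N : Type*} [AddCommGroup N] [Module R N]
    (g : ∀ t, Abelian.Ext (quotPow J t) M i →ₗ[R] N)
    (hg : ∀ t t' (h : t ≤ t') e, g t' (extTransition J i M t t' h e) = g t e) (t : ℕ)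
    (e : Abelian.Ext (quotPow J t) M i) : LimExt.lift J g hg (LimExt.of J t e) = g t e :=
  Module.DirectLimit.lift_of _ _ _

lemma LimExt.exists_of (x : LimExt J i M) : ∃ t e, LimExt.of J t e = x :=
  Module.DirectLimit.exists_of x

lemma LimExt.of_eq_zero {t : ℕ} {e : Abelian.Ext (quotPow J t) M i} (h : LimExt.of J t e = 0) :
    ∃ t', ∃ h : t ≤ t', (Abelian.Ext.mk₀ (quotPowMap J h)).comp e (zero_add i) = 0 :=
  Module.DirectLimit.of.zero_exact (f := extTransition J i M) h

lemma LimExt.of_comp {t t' : ℕ} (h : t ≤ t') (e : Abelian.Ext (quotPow J t) M i) :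
    LimExt.of J t' ((Abelian.Ext.mk₀ (quotPowMap J h)).comp e (zero_add i)) = LimExt.of J t e :=
  Module.DirectLimit.of_f (f := extTransition J i M) (hij := h)

section Comparison

/-- The cocone describing the local cohomology of `M`. -/
def localCohomologyLeg (J : Ideal R) (i : ℕ) (M : ModuleCat.{u} R) (t : ℕ) :
    ((Ext R (ModuleCat.{u} R) i).obj (op (quotPow J t))).obj M ⟶
      (localCohomology J i).obj M :=
  (colimit.ι (localCohomology.diagram (localCohomology.idealPowersDiagram J) i) (op (op t))).app M

lemma localCohomologyLeg_transition {t t' : ℕ} (h : t ≤ t')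
    (e : Abelian.Ext (quotPow J t) M i) :
    (localCohomologyLeg J i M t').hom (extEquivDerivedExt _ M i
      ((Abelian.Ext.mk₀ (quotPowMap J h)).comp e (zero_add i))) =
    (localCohomologyLeg J i M t).hom (extEquivDerivedExt _ M i e) := by
  rw [extEquivDerivedExt_naturality]
  have := colimit.w (localCohomology.diagram (localCohomology.idealPowersDiagram J) i)
    (homOfLE h).op.op
  exact congrArg (fun f => (f.app M).hom (extEquivDerivedExt _ M i e)) this

/-- The comparison map from the limit of the `Ext` modules to local cohomology. -/
def limExtToLocalCohomology (J : Ideal R) (i : ℕ) (M : ModuleCat.{u} R) :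
    LimExt J i M →ₗ[R] (localCohomology J i).obj M :=
  LimExt.lift J
    (fun t => (localCohomologyLeg J i M t).hom ∘ₗ (extEquivDerivedExt (quotPow J t) M i).toLinearMap)
    (fun _ _ h e => localCohomologyLeg_transition J h e)

lemma limExtToLocalCohomology_of (t : ℕ) (e : Abelian.Ext (quotPow J t) M i) :
    limExtToLocalCohomology J i M (LimExt.of J t e) =
      (localCohomologyLeg J i M t).hom (extEquivDerivedExt (quotPow J t) M i e) :=
  LimExt.lift_of J _ _ _ _

/-- Evaluation of the colimit defining local cohomology is a colimit. -/
def isColimitLocalCohomology (J : Ideal R) (i : ℕ) (M : ModuleCat.{u} R) :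
    IsColimit (((evaluation (ModuleCat.{u} R) (ModuleCat.{u} R)).obj M).mapCocone
      (colimit.cocone (localCohomology.diagram (localCohomology.idealPowersDiagram J) i))) :=
  isColimitOfPreserves _ (colimit.isColimit _)

lemma limExtToLocalCohomology_bijective (J : Ideal R) (i : ℕ) (M : ModuleCat.{u} R) :
    Function.Bijective (limExtToLocalCohomology J i M) := by
  -- The powers of `J` are indexed by a category in universe 0, so the forgetful functor is needed
  -- at that size.
  have : PreservesFilteredColimitsOfSize.{0, 0} (forget (ModuleCat.{u} R)) :=
    preservesSmallestFilteredColimits_of_preservesFilteredColimits _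
  constructor
  · rw [injective_iff_map_eq_zero]
    intro x hx
    obtain ⟨t, e, rfl⟩ := LimExt.exists_of J x
    rw [limExtToLocalCohomology_of] at hx
    obtain ⟨k, f, g, h⟩ := Concrete.isColimit_exists_of_rep_eq _ (isColimitLocalCohomology J i M)
      (i := op (op t)) (j := op (op t)) (extEquivDerivedExt (quotPow J t) M i e) 0
      (hx.trans (map_zero _).symm)
    rw [map_zero] at h
    have hle : t ≤ k.unop.unop := leOfHom f.unop.unop
    have h0 : (Abelian.Ext.mk₀ (quotPowMap J hle)).comp e (zero_add i) = 0 := by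
      apply (extEquivDerivedExt _ M i).injective
      rw [extEquivDerivedExt_naturality, map_zero]
      exact h
    rw [← LimExt.of_comp J hle, h0, map_zero]
  · intro y
    obtain ⟨j, z, hz⟩ := Concrete.isColimit_exists_rep _ (isColimitLocalCohomology J i M) y
    refine ⟨LimExt.of J j.unop.unop ((extEquivDerivedExt (quotPow J j.unop.unop) M i).symm z), ?_⟩
    rw [limExtToLocalCohomology_of]
    exact (congrArg _ ((extEquivDerivedExt _ M i).apply_symm_apply z)).trans hz

/-- Local cohomology is the direct limit of `Ext^i(R / J ^ t, M)`. -/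
def limExtEquivLocalCohomology (J : Ideal R) (i : ℕ) (M : ModuleCat.{u} R) :
    LimExt J i M ≃ₗ[R] (localCohomology J i).obj M :=
  LinearEquiv.ofBijective _ (limExtToLocalCohomology_bijective J i M)

end Comparison

/-! ### Functoriality and the long exact sequence -/

section Postcomp

variable {N L : ModuleCat.{u} R}

/-- The map induced on limits by an element of `Ext^n(M, N)`. -/
def LimExt.postcomp {i n j : ℕ} (φ : Abelian.Ext M N n) (h : i + n = j) :
    LimExt J i M →ₗ[R] LimExt J j N :=
  LimExt.lift J
    (fun t =>
      { toFun e := LimExt.of J t (e.comp φ h)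
        map_add' x y := by rw [Abelian.Ext.add_comp, map_add]
        map_smul' r x := by rw [Abelian.Ext.smul_comp, map_smul, RingHom.id_apply] })
    (fun t t' htt' e => by
      have key : ((Abelian.Ext.mk₀ (quotPowMap J htt')).comp e (zero_add i)).comp φ h =
        (Abelian.Ext.mk₀ (quotPowMap J htt')).comp (e.comp φ h) (zero_add j) :=
        Abelian.Ext.comp_assoc _ _ _ _ _ (by lia)
      rw [extTransition_apply]
      simp only [LinearMap.coe_mk, AddHom.coe_mk]
      rw [key, LimExt.of_comp])

lemma LimExt.postcomp_of {i n j : ℕ} (φ : Abelian.Ext M N n) (h : i + n = j) {t : ℕ}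
    (e : Abelian.Ext (quotPow J t) M i) :
    LimExt.postcomp J φ h (LimExt.of J t e) = LimExt.of J t (e.comp φ h) :=
  LimExt.lift_of J _ _ _ _

lemma LimExt.postcomp_postcomp {i m n j k l : ℕ} (φ : Abelian.Ext M N m) (ψ : Abelian.Ext N L n)
    (h : i + m = j) (h' : j + n = k) (h'' : m + n = l) (x : LimExt J i M) :
    LimExt.postcomp J ψ h' (LimExt.postcomp J φ h x) =
      LimExt.postcomp J (φ.comp ψ h'') (by lia) x := by
  obtain ⟨t, e, rfl⟩ := LimExt.exists_of J x
  rw [LimExt.postcomp_of, LimExt.postcomp_of, LimExt.postcomp_of]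
  congr 1
  exact Abelian.Ext.comp_assoc _ _ _ _ _ (by lia)

/-- Functoriality of `LimExt` in the module. -/
abbrev LimExt.map (i : ℕ) (f : M ⟶ N) : LimExt J i M →ₗ[R] LimExt J i N :=
  LimExt.postcomp J (Abelian.Ext.mk₀ f) (add_zero i)

lemma LimExt.map_map (f : M ⟶ N) (g : N ⟶ L) (x : LimExt J i M) :
    LimExt.map J i g (LimExt.map J i f x) = LimExt.map J i (f ≫ g) x := by
  rw [LimExt.postcomp_postcomp J _ _ _ _ (add_zero 0), Abelian.Ext.mk₀_comp_mk₀]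

lemma LimExt.map_smul_id (r : R) (x : LimExt J i M) :
    LimExt.map J i (r • 𝟙 M) x = r • x := by
  obtain ⟨t, e, rfl⟩ := LimExt.exists_of J x
  rw [LimExt.postcomp_of, ← Abelian.Ext.smul_eq_comp_mk₀, map_smul]

lemma LimExt.postcomp_zero {i n j : ℕ} (h : i + n = j) (x : LimExt J i M) :
    LimExt.postcomp J (0 : Abelian.Ext M N n) h x = 0 := by
  obtain ⟨t, e, rfl⟩ := LimExt.exists_of J x
  rw [LimExt.postcomp_of, Abelian.Ext.comp_zero, map_zero]

variable {S : ShortComplex (ModuleCat.{u} R)} (hS : S.ShortExact)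

include hS in
-- Exactness passes to the limit: a relation that holds in the limit already holds at some finite
-- stage t', where the sequence for `Ext` applies.
lemma LimExt.exact₂ (x : LimExt J i S.X₂) (hx : LimExt.map J i S.g x = 0) :
    ∃ y, LimExt.map J i S.f y = x := by
  obtain ⟨t, e, rfl⟩ := LimExt.exists_of J x
  rw [LimExt.postcomp_of] at hx
  obtain ⟨t', h, h0⟩ := LimExt.of_eq_zero J hx
  rw [← Abelian.Ext.comp_assoc _ _ _ (zero_add i) (add_zero i) (by lia)] at h0
  obtain ⟨e', he'⟩ := Abelian.Ext.covariant_sequence_exact₂ _ hS _ h0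
  exact ⟨LimExt.of J t' e', by rw [LimExt.postcomp_of, he', LimExt.of_comp]⟩

/-- The connecting homomorphism. -/
abbrev LimExt.δ {i j : ℕ} (h : i + 1 = j) : LimExt J i S.X₃ →ₗ[R] LimExt J j S.X₁ :=
  LimExt.postcomp J hS.extClass h

lemma LimExt.exact₃ {j : ℕ} (h : i + 1 = j) (x : LimExt J i S.X₃) (hx : LimExt.δ J hS h x = 0) :
    ∃ y, LimExt.map J i S.g y = x := by
  obtain ⟨t, e, rfl⟩ := LimExt.exists_of J x
  rw [LimExt.postcomp_of] at hx
  obtain ⟨t', h', h0⟩ := LimExt.of_eq_zero J hx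
  rw [← Abelian.Ext.comp_assoc _ _ _ (zero_add i) h (by lia)] at h0
  obtain ⟨e', he'⟩ := Abelian.Ext.covariant_sequence_exact₃ _ hS _ h h0
  exact ⟨LimExt.of J t' e', by rw [LimExt.postcomp_of, he', LimExt.of_comp]⟩

lemma LimExt.exact₁ {j : ℕ} (h : i + 1 = j) (x : LimExt J j S.X₁)
    (hx : LimExt.map J j S.f x = 0) : ∃ y, LimExt.δ J hS h y = x := by
  obtain ⟨t, e, rfl⟩ := LimExt.exists_of J x
  rw [LimExt.postcomp_of] at hx
  obtain ⟨t', h', h0⟩ := LimExt.of_eq_zero J hx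
  rw [← Abelian.Ext.comp_assoc _ _ _ (zero_add j) (add_zero j) (by lia)] at h0
  obtain ⟨e', he'⟩ := Abelian.Ext.covariant_sequence_exact₁ _ hS _ h0 h
  exact ⟨LimExt.of J t' e', by rw [LimExt.postcomp_of, he', LimExt.of_comp]⟩

lemma LimExt.δ_map {j : ℕ} (h : i + 1 = j) (x : LimExt J i S.X₂) :
    LimExt.δ J hS h (LimExt.map J i S.g x) = 0 := by
  rw [LimExt.postcomp_postcomp J _ _ _ _ (zero_add 1), hS.comp_extClass, LimExt.postcomp_zero]

/-- If `H^i(S.X₂) = H^{i+1}(S.X₂) = 0`, the connecting homomorphism is an isomorphism. -/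
lemma LimExt.δ_bijective {j : ℕ} (h : i + 1 = j) [Subsingleton (LimExt J i S.X₂)]
    [Subsingleton (LimExt J j S.X₂)] : Function.Bijective (LimExt.δ J hS h) := by
  constructor
  · rw [injective_iff_map_eq_zero]
    intro x hx
    obtain ⟨y, rfl⟩ := LimExt.exact₃ J hS h x hx
    rw [Subsingleton.elim y 0, map_zero]
  · exact fun x => LimExt.exact₁ J hS h x (Subsingleton.elim _ _)

include hS in
/-- If `H^i(S.X₁) = H^{i+1}(S.X₁) = 0`, then `H^i(S.X₂) → H^i(S.X₃)` is an isomorphism. -/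
lemma LimExt.map_bijective [Subsingleton (LimExt J i S.X₁)]
    [Subsingleton (LimExt J (i + 1) S.X₁)] : Function.Bijective (LimExt.map J i S.g) := by
  constructor
  · rw [injective_iff_map_eq_zero]
    intro x hx
    obtain ⟨y, rfl⟩ := LimExt.exact₂ J hS x hx
    rw [Subsingleton.elim y 0, map_zero]
  · exact fun x => LimExt.exact₃ J hS rfl x (Subsingleton.elim _ _)

end Postcomp

/-! ### Torsion and vanishing of local cohomology -/

section Torsion

/-- A class coming from Ext^i(R/J^t, M) is killed by J^t through the first argument. -/
lemma LimExt.exists_pow_smul_eq_zero (x : LimExt J i M) : ∃ t, ∀ r ∈ J ^ t, r • x = 0 := by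
  obtain ⟨t, e, rfl⟩ := LimExt.exists_of J x
  refine ⟨t, fun r hr => ?_⟩
  have h0 : r • 𝟙 (quotPow J t) = 0 := by
    apply ModuleCat.hom_ext
    refine LinearMap.ext fun x => ?_
    obtain ⟨x, rfl⟩ := Ideal.Quotient.mk_surjective x
    exact Ideal.Quotient.eq_zero_iff_mem.2 (Ideal.mul_mem_right x _ hr)
  have h1 : r • e = (r • Abelian.Ext.mk₀ (𝟙 (quotPow J t))).comp e (zero_add i) := by
    rw [Abelian.Ext.smul_comp, Abelian.Ext.mk₀_id_comp]
  rw [← map_smul, h1, ← Abelian.Ext.mk₀_smul, h0, Abelian.Ext.mk₀_zero, Abelian.Ext.zero_comp,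
    map_zero]

/-- By functoriality `r` acts injectively on cohomology, yet some power of `r` kills each class. -/
lemma LimExt.subsingleton_of_bijective_smul {r : R} (hr : r ∈ J)
    (h : Function.Bijective (fun m : M => r • m)) : Subsingleton (LimExt J i M) := by
  have hiso : IsIso (r • 𝟙 M) := (ConcreteCategory.isIso_iff_bijective (r • 𝟙 M)).2 h
  have hinj : Function.Injective (fun x : LimExt J i M => r • x) := by
    intro x y hxy
    have key : ∀ z : LimExt J i M, LimExt.map J i (inv (r • 𝟙 M)) (r • z) = z := fun z => by
      rw [← LimExt.map_smul_id, LimExt.map_map, IsIso.hom_inv_id, ← one_smul R (𝟙 M),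
        LimExt.map_smul_id, one_smul]
    rw [← key x, ← key y]
    exact congrArg _ hxy
  refine subsingleton_of_forall_eq 0 fun x => ?_
  obtain ⟨t, ht⟩ := LimExt.exists_pow_smul_eq_zero J x
  have h2 := hinj.iterate t
  rw [smul_iterate] at h2
  apply h2
  simp only [smul_zero]
  exact ht _ (Ideal.pow_mem_pow hr t)

lemma LimExt.subsingleton_of_injective [Injective M] : Subsingleton (LimExt J (i + 1) M) := by
  refine subsingleton_of_forall_eq 0 fun x => ?_
  obtain ⟨t, e, rfl⟩ := LimExt.exists_of J x
  rw [Abelian.Ext.eq_zero_of_injective e, map_zero]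

end Torsion

/-! ### Degree zero: elements killed by a power of `J` -/

section DegreeZero

/-- The map `H^0_J(M) → M`. -/
def LimExt.eval (M : ModuleCat.{u} R) : LimExt J 0 M →ₗ[R] M :=
  LimExt.lift J
    (fun t =>
      { toFun e := (Abelian.Ext.linearEquiv₀ (R := R) e).hom (1 : R ⧸ J ^ t)
        map_add' x y := by rw [map_add]; rfl
        map_smul' r x := by rw [map_smul]; rfl })
    (fun t t' h e => by
      obtain ⟨f, rfl⟩ := (Abelian.Ext.linearEquiv₀ (R := R)).symm.surjective e
      have : extTransition J 0 M t t' h ((Abelian.Ext.linearEquiv₀ (R := R)).symm f) =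
          (Abelian.Ext.linearEquiv₀ (R := R)).symm (quotPowMap J h ≫ f) := by
        rw [extTransition_apply]
        exact Abelian.Ext.mk₀_comp_mk₀ _ _
      simp only [LinearMap.coe_mk, AddHom.coe_mk]
      rw [this, LinearEquiv.apply_symm_apply, LinearEquiv.apply_symm_apply]
      rfl)

lemma LimExt.eval_of {t : ℕ} (f : quotPow J t ⟶ M) :
    LimExt.eval J M (LimExt.of J t (Abelian.Ext.mk₀ f)) = f.hom (1 : R ⧸ J ^ t) := by
  refine (LimExt.lift_of J _ _ _ _).trans ?_
  simp only [LinearMap.coe_mk, AddHom.coe_mk]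
  exact congrArg (fun g : quotPow J t ⟶ M => g.hom (1 : R ⧸ J ^ t))
    ((Abelian.Ext.linearEquiv₀ (R := R)).apply_symm_apply f)

lemma LimExt.exists_of_mk₀ (x : LimExt J 0 M) :
    ∃ t, ∃ f : quotPow J t ⟶ M, LimExt.of J t (Abelian.Ext.mk₀ f) = x := by
  obtain ⟨t, e, rfl⟩ := LimExt.exists_of J x
  obtain ⟨f, rfl⟩ := (Abelian.Ext.linearEquiv₀ (R := R)).symm.surjective e
  exact ⟨t, f, rfl⟩

lemma LimExt.eval_map {N : ModuleCat.{u} R} (f : M ⟶ N) (x : LimExt J 0 M) :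
    LimExt.eval J N (LimExt.map J 0 f x) = f.hom (LimExt.eval J M x) := by
  obtain ⟨t, g, rfl⟩ := LimExt.exists_of_mk₀ J x
  rw [LimExt.postcomp_of, Abelian.Ext.mk₀_comp_mk₀, LimExt.eval_of, LimExt.eval_of]
  rfl

lemma LimExt.eval_injective : Function.Injective (LimExt.eval J M) := by
  rw [injective_iff_map_eq_zero]
  intro x hx
  obtain ⟨t, g, rfl⟩ := LimExt.exists_of_mk₀ J x
  rw [LimExt.eval_of] at hx
  have : g = 0 := by
    apply ModuleCat.hom_ext
    refine LinearMap.ext fun x => ?_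
    obtain ⟨r, rfl⟩ := Ideal.Quotient.mk_surjective x
    have h1 : (Ideal.Quotient.mk (J ^ t) r : quotPow J t) = r • (1 : R ⧸ J ^ t) := by
      rw [Algebra.smul_def, mul_one]; rfl
    exact (congrArg g.hom h1).trans ((g.hom.map_smul r _).trans (by rw [hx, smul_zero]; rfl))
  rw [this, Abelian.Ext.mk₀_zero, map_zero]

lemma LimExt.mem_range_eval {m : M} {t : ℕ} (h : ∀ r ∈ J ^ t, r • m = 0) :
    ∃ x, LimExt.eval J M x = m := by
  let f : quotPow J t ⟶ M := ModuleCat.ofHom ((J ^ t).liftQ (LinearMap.toSpanSingleton R M m) h)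
  refine ⟨LimExt.of J t (Abelian.Ext.mk₀ f), ?_⟩
  rw [LimExt.eval_of]
  exact one_smul R (m : M)

end DegreeZero

end LimExt

end

end TopLocalCohomology

namespace TopLocalCohomology

noncomputable section

open CategoryTheory Opposite Limits Abelian

/-! ### Torsion modules and injectivity of the torsion submodule -/

section PowTorsion

variable {R : Type u} [CommRing R] {K : Ideal R}

/-- A module is `K`-torsion if every element of `K` has a power killing any given element. -/
def IsPowTorsion (K : Ideal R) (N : Type*) [AddCommGroup N] [Module R N] : Prop :=
  ∀ n : N, K ≤ (Ideal.torsionOf R N n).radical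

lemma IsPowTorsion.sup {K' : Ideal R} {N : Type*} [AddCommGroup N] [Module R N]
    (h : IsPowTorsion K N) (h' : IsPowTorsion K' N) : IsPowTorsion (K ⊔ K') N :=
  fun n => sup_le (h n) (h' n)

lemma isPowTorsion_span_singleton {r : R} {N : Type*} [AddCommGroup N] [Module R N]
    (h : ∀ n : N, ∃ t : ℕ, r ^ t • n = 0) : IsPowTorsion (Ideal.span {r}) N := fun n => by
  rw [Ideal.span_singleton_le_iff_mem]
  exact h n

lemma IsPowTorsion.of_injective {N N' : Type*} [AddCommGroup N] [Module R N] [AddCommGroup N']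
    [Module R N'] (h : IsPowTorsion K N') (f : N →ₗ[R] N') (hf : Function.Injective f) :
    IsPowTorsion K N := fun n r hr => by
  obtain ⟨t, ht⟩ := h (f n) hr
  refine ⟨t, hf ?_⟩
  rw [map_zero]
  exact (map_smul f _ n).trans ht

lemma IsPowTorsion.of_surjective {N N' : Type*} [AddCommGroup N] [Module R N] [AddCommGroup N']
    [Module R N'] (h : IsPowTorsion K N) (f : N →ₗ[R] N') (hf : Function.Surjective f) :
    IsPowTorsion K N' := fun n r hr => by
  obtain ⟨n, rfl⟩ := hf n
  obtain ⟨t, ht⟩ := h n hr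
  refine ⟨t, ?_⟩
  exact (map_smul f _ n).symm.trans ((congrArg f ht).trans (map_zero f))

lemma IsPowTorsion.exists_pow [IsNoetherianRing R] {N : Type*} [AddCommGroup N] [Module R N]
    (h : IsPowTorsion K N) (n : N) : ∃ t, ∀ r ∈ K ^ t, r • n = 0 :=
  Ideal.exists_pow_le_of_le_radical_of_fg (h n) (IsNoetherian.noetherian K)

variable (K) in
/-- The `K`-torsion submodule `Γ_K(M)`. -/
def powTorsion (M : Type*) [AddCommGroup M] [Module R M] : Submodule R M where
  carrier := {m | K ≤ (Ideal.torsionOf R M m).radical}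
  zero_mem' := fun r _ => ⟨0, smul_zero _⟩
  add_mem' := fun {x y} hx hy r hr => by
    obtain ⟨s, hs : r ^ s • x = 0⟩ := hx hr
    obtain ⟨t, ht : r ^ t • y = 0⟩ := hy hr
    refine ⟨s + t, ?_⟩
    change r ^ (s + t) • (x + y) = 0
    rw [smul_add, pow_add, mul_smul, mul_smul, smul_comm (r ^ s) (r ^ t) x,
      hs, ht, smul_zero, smul_zero, add_zero]
  smul_mem' := fun a x hx r hr => by
    obtain ⟨s, hs : r ^ s • x = 0⟩ := hx hr
    refine ⟨s, ?_⟩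
    change r ^ s • a • x = 0
    rw [smul_comm, hs, smul_zero]

lemma isPowTorsion_powTorsion (M : Type*) [AddCommGroup M] [Module R M] :
    IsPowTorsion K (powTorsion K M) := fun m r hr => by
  obtain ⟨t, ht⟩ := m.2 hr
  exact ⟨t, Subtype.ext ht⟩

/-- Over a Noetherian ring, the torsion submodule of an injective module is injective. -/
lemma powTorsion_injective [IsNoetherianRing R] (M : Type u) [AddCommGroup M] [Module R M]
    [hM : Module.Injective R M] : Module.Injective R (powTorsion K M) := by
  apply Module.Baer.injective
  intro I g
  -- The ideal `I` is finitely generated, so one power of `K` kills the whole image of `g`.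
  obtain ⟨n, hn⟩ : ∃ n, ∀ x : I, ∀ r ∈ K ^ n, r • g x = 0 := by
    obtain ⟨S, hS⟩ := IsNoetherian.noetherian (⊤ : Submodule R I)
    choose t ht using fun x : I => (isPowTorsion_powTorsion M).exists_pow (K := K) (g x)
    refine ⟨S.sup t, fun x r hr => ?_⟩
    have hx : x ∈ Submodule.span R (S : Set I) := hS ▸ Submodule.mem_top
    induction hx using Submodule.span_induction with
    | mem x hx => exact ht x r (Ideal.pow_le_pow_right (Finset.le_sup hx) hr)
    | zero => rw [map_zero, smul_zero]
    | add x y _ _ hx hy => rw [map_add, smul_add, hx, hy, add_zero]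
    | smul a x _ hx => rw [map_smul, smul_comm, hx, smul_zero]
  -- Artin–Rees: I ∩ K^{n+k} ⊆ K^n I, which `g` kills. So `g` factors through a submodule of
  -- R/K^{n+k}; any extension to R/K^{n+k} sends 1 to a torsion element.
  obtain ⟨k, hk⟩ := Ideal.exists_pow_inf_eq_pow_smul (M := R) K I
  have hg : ∀ x : I, (x : R) ∈ K ^ (n + k) → g x = 0 := by
    intro x hx
    have h1 : (x : R) ∈ K ^ (n + k) • (⊤ : Ideal R) ⊓ I :=
      ⟨by rwa [smul_eq_mul, Ideal.mul_top], x.2⟩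
    rw [hk _ (Nat.le_add_left k n), Nat.add_sub_cancel] at h1
    have h2 : (x : R) ∈ Submodule.map (Submodule.subtype I) (K ^ n • (⊤ : Submodule R I)) := by
      rw [Submodule.map_smul'', Submodule.map_top, Submodule.range_subtype]
      exact Submodule.smul_mono le_rfl inf_le_right h1
    obtain ⟨y, hy, hyx⟩ := h2
    obtain rfl : y = x := Subtype.ext hyx
    refine Submodule.smul_induction_on hy (fun r hr z _ => ?_) (fun a b ha hb => ?_)
    · rw [map_smul, hn z r hr]
    · rw [map_add, ha, hb, add_zero]
  let f : (I ⧸ Submodule.comap (Submodule.subtype I) (K ^ (n + k))) →ₗ[R] (R ⧸ K ^ (n + k)) :=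
    Submodule.mapQ _ _ (Submodule.subtype I) le_rfl
  have hf : Function.Injective f := by
    rw [← LinearMap.ker_eq_bot, Submodule.ker_mapQ, Submodule.mkQ_map_self]
  let g' : (I ⧸ Submodule.comap (Submodule.subtype I) (K ^ (n + k))) →ₗ[R] M :=
    Submodule.liftQ _ ((powTorsion K M).subtype ∘ₗ g) (fun x hx => by
      rw [LinearMap.mem_ker, LinearMap.comp_apply, hg x hx, map_zero])
  obtain ⟨G, hG⟩ := hM.out f hf g'
  have hmem : G (Submodule.Quotient.mk 1) ∈ powTorsion K M := by
    intro r hr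
    refine ⟨n + k, ?_⟩
    change r ^ (n + k) • G (Submodule.Quotient.mk 1) = 0
    rw [← map_smul, ← Submodule.Quotient.mk_smul, smul_eq_mul, mul_one,
      (Submodule.Quotient.mk_eq_zero _).2 (Ideal.pow_mem_pow hr _), map_zero]
  refine ⟨LinearMap.toSpanSingleton R _ ⟨_, hmem⟩, fun x mem => Subtype.ext ?_⟩
  have h3 := hG (Submodule.Quotient.mk ⟨x, mem⟩)
  refine Eq.trans ?_ h3
  change x • G (Submodule.Quotient.mk 1) = G (Submodule.Quotient.mk x)
  rw [← map_smul, ← Submodule.Quotient.mk_smul, smul_eq_mul, mul_one]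

end PowTorsion

/-! ### Vanishing of higher local cohomology on torsion modules -/

section Vanishing

variable {R : Type u} [CommRing R] (J : Ideal R)

lemma shortExact_of_linearMap {A B C : Type u} [AddCommGroup A] [Module R A] [AddCommGroup B]
    [Module R B] [AddCommGroup C] [Module R C] (f : A →ₗ[R] B) (g : B →ₗ[R] C)
    (hf : Function.Injective f) (hg : Function.Surjective g) (hfg : Function.Exact f g) :
    (ShortComplex.mk (ModuleCat.ofHom f) (ModuleCat.ofHom g)
      (ModuleCat.hom_ext hfg.linearMap_comp_eq_zero)).ShortExact where
  exact := (ShortComplex.ShortExact.moduleCat_exact_iff_function_exact _).2 hfg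
  mono_f := (ModuleCat.mono_iff_injective _).2 hf
  epi_g := (ModuleCat.epi_iff_surjective _).2 hg

variable [IsNoetherianRing R]

/-- The higher local cohomology of a torsion module vanishes. -/
lemma LimExt.subsingleton_of_isPowTorsion (i : ℕ) (N : Type u) [AddCommGroup N] [Module R N]
    (hN : IsPowTorsion J N) : Subsingleton (LimExt J (i + 1) (ModuleCat.of R N)) := by
  induction i using Nat.strong_induction_on generalizing N with | _ i ih => ?_
  -- Dimension shifting: embed `N` in the torsion part of an injective module, which is again
  -- injective and has torsion cokernel.
  obtain ⟨E, hE, f, hf⟩ : ∃ (E : ModuleCat.{u} R) (_ : Injective E) (f : N →ₗ[R] E),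
      Function.Injective f :=
    ⟨Injective.under (ModuleCat.of R N), inferInstance, (Injective.ι (ModuleCat.of R N)).hom,
      (ModuleCat.mono_iff_injective _).1 inferInstance⟩
  have hE' : Module.Injective R E := (Module.injective_iff_injective_object R E).2 hE
  have := powTorsion_injective (K := J) E
  have := Module.injective_object_of_injective_module R (powTorsion J E)
  let f' : N →ₗ[R] powTorsion J E := f.codRestrict _ (fun n r hr => by
    obtain ⟨t, ht⟩ := hN n hr
    exact ⟨t, (map_smul f _ n).symm.trans ((congrArg f ht).trans (map_zero f))⟩)
  have hf' : Function.Injective f' := (LinearMap.injective_codRestrict_iff _).2 hf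
  have htE : IsPowTorsion J (powTorsion J E) := isPowTorsion_powTorsion E
  have htQ : IsPowTorsion J (powTorsion J E ⧸ LinearMap.range f') :=
    htE.of_surjective _ (Submodule.mkQ_surjective _)
  have hS := shortExact_of_linearMap f' (LinearMap.range f').mkQ hf'
    (Submodule.mkQ_surjective _) (LinearMap.exact_map_mkQ_range f')
  cases i with
  | zero =>
    have := LimExt.subsingleton_of_injective J (i := 0) (M := ModuleCat.of R (powTorsion J E))
    refine subsingleton_of_forall_eq 0 fun x => ?_
    obtain ⟨y, rfl⟩ := LimExt.exact₁ J hS (zero_add 1) x (Subsingleton.elim _ _)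
    -- On torsion modules H^0 is the module itself, so H^0 of the injective maps onto H^0 of the
    -- cokernel and the connecting map is zero.
    obtain ⟨e, he⟩ := Submodule.mkQ_surjective _ (LimExt.eval J _ y)
    obtain ⟨t, ht⟩ := htE.exists_pow e
    obtain ⟨z, hz⟩ := LimExt.mem_range_eval J (M := ModuleCat.of R (powTorsion J E)) ht
    have : LimExt.map J 0 (ModuleCat.ofHom (LinearMap.range f').mkQ) z = y := by
      apply LimExt.eval_injective J
      rw [LimExt.eval_map, hz]
      exact he
    rw [← this]
    exact LimExt.δ_map J hS _ z
  | succ i =>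
    have := LimExt.subsingleton_of_injective J (i := i + 1) (M := ModuleCat.of R (powTorsion J E))
    have := ih i (Nat.lt_succ_self i) _ htQ
    refine subsingleton_of_forall_eq 0 fun x => ?_
    obtain ⟨y, rfl⟩ := LimExt.exact₁ J hS (rfl : i + 1 + 1 = _) x (Subsingleton.elim _ _)
    rw [(Subsingleton.elim y 0 : y = 0), map_zero]

end Vanishing

end

end TopLocalCohomology

namespace TopLocalCohomology

noncomputable section

open CategoryTheory Opposite Limits Abelian

/-! ### Top local cohomology as a limit of N/(u_1^t, …, u_j^t)N -/

section TopDegree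

variable {R : Type u} [CommRing R]

/-- `H` is the direct limit of the modules `N / (u₁ ^ t, …, uⱼ ^ t) N` along multiplication by
`u₁ ⋯ uⱼ`: there are maps `g t : N → H`, thought of as `n ↦ n / (u₁ ⋯ uⱼ) ^ t`. -/
def IsTopCech {j : ℕ} (u : Fin j → R) (N H : Type*) [AddCommGroup N] [Module R N]
    [AddCommGroup H] [Module R H] : Prop :=
  ∃ g : ℕ → N →ₗ[R] H,
    (∀ t k n, g (t + k) ((∏ i, u i) ^ k • n) = g t n) ∧
    (∀ h, ∃ t n, g t n = h) ∧
    (∀ t n, g t n = 0 ↔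
      ∃ (k : ℕ) (c : Fin j → N), (∏ i, u i) ^ k • n = ∑ i, u i ^ (t + k) • c i)

lemma IsTopCech.of_equiv {j : ℕ} {u : Fin j → R} {N H H' : Type*} [AddCommGroup N] [Module R N]
    [AddCommGroup H] [Module R H] [AddCommGroup H'] [Module R H'] (e : H ≃ₗ[R] H')
    (h : IsTopCech u N H) : IsTopCech u N H' := by
  obtain ⟨g, h1, h2, h3⟩ := h
  refine ⟨fun t => e.toLinearMap ∘ₗ g t, fun t k n => congrArg e (h1 t k n), fun h => ?_,
    fun t n => ?_⟩
  · obtain ⟨t, n, hn⟩ := h2 (e.symm h)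
    exact ⟨t, n, by simp [hn]⟩
  · rw [← h3]
    simp

lemma isTopCech_zero (u : Fin 0 → R) {N H : Type*} [AddCommGroup N] [Module R N]
    [AddCommGroup H] [Module R H] (e : N ≃ₗ[R] H) : IsTopCech u N H := by
  refine ⟨fun _ => e.toLinearMap, fun t k n => by simp, fun h => ⟨0, e.symm h, by simp⟩,
    fun t n => ?_⟩
  simp

variable (a : R) (N : Type u) [AddCommGroup N] [Module R N]

/-- The localization `N_a`. -/
abbrev AwayModule : Type u := LocalizedModule (Submonoid.powers a) N

/-- The image of `N` in `N_a`. -/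
abbrev awayImage : Submodule R (AwayModule a N) :=
  LinearMap.range (LocalizedModule.mkLinearMap (Submonoid.powers a) N)

/-- The quotient `N_a / N`. -/
abbrev AwayQuot : Type u := AwayModule a N ⧸ awayImage a N

/-- The map `n ↦ n / a ^ t`. -/
def awayDiv (t : ℕ) : N →ₗ[R] AwayQuot a N :=
  (awayImage a N).mkQ ∘ₗ LocalizedModule.divBy ⟨a ^ t, t, rfl⟩ ∘ₗ
    LocalizedModule.mkLinearMap (Submonoid.powers a) N

lemma awayDiv_apply (t : ℕ) (n : N) :
    awayDiv a N t n =
      Submodule.Quotient.mk (LocalizedModule.mk n (⟨a ^ t, t, rfl⟩ : Submonoid.powers a)) := by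
  simp [awayDiv, LocalizedModule.mkLinearMap_apply, LocalizedModule.divBy_apply,
    LocalizedModule.liftOn_mk]

lemma awayDiv_add (t k : ℕ) (n : N) : awayDiv a N (t + k) (a ^ k • n) = awayDiv a N t n := by
  rw [awayDiv_apply, awayDiv_apply]
  congr 1
  rw [LocalizedModule.mk_eq]
  refine ⟨1, ?_⟩
  rw [one_smul, one_smul]
  change a ^ t • a ^ k • n = a ^ (t + k) • n
  rw [smul_smul, pow_add]

lemma awayDiv_self (t : ℕ) (n : N) : awayDiv a N t (a ^ t • n) = 0 := by
  rw [awayDiv_apply, Submodule.Quotient.mk_eq_zero]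
  refine ⟨n, ?_⟩
  rw [LocalizedModule.mkLinearMap_apply, LocalizedModule.mk_eq]
  refine ⟨1, ?_⟩
  rw [one_smul, one_smul, one_smul]
  rfl

lemma awayDiv_surjective (q : AwayQuot a N) : ∃ t n, awayDiv a N t n = q := by
  obtain ⟨x, rfl⟩ := Submodule.Quotient.mk_surjective _ q
  induction x using LocalizedModule.induction_on with | h n s => ?_
  obtain ⟨_, t, rfl⟩ := s
  exact ⟨t, n, awayDiv_apply a N t n⟩

lemma awayDiv_eq_zero {t : ℕ} {n : N} (h : awayDiv a N t n = 0) :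
    ∃ b m, a ^ b • n = a ^ (b + t) • (m : N) := by
  rw [awayDiv_apply, Submodule.Quotient.mk_eq_zero] at h
  obtain ⟨m, hm⟩ := h
  rw [LocalizedModule.mkLinearMap_apply, LocalizedModule.mk_eq] at hm
  obtain ⟨⟨_, b, rfl⟩, hb⟩ := hm
  have hb' : a ^ b • a ^ t • m = a ^ b • (1 : R) • n := hb
  exact ⟨b, m, by rw [pow_add, mul_smul, hb', one_smul]⟩

lemma away_smul_bijective : Function.Bijective (fun x : AwayModule a N => a • x) :=
  (Module.End.isUnit_iff _).1
    (IsLocalizedModule.map_units (LocalizedModule.mkLinearMap (Submonoid.powers a) N)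
      ⟨a, Submonoid.mem_powers a⟩)

/-- Shows that the kernel of N → N_a is torsion for `a`, so that the vanishing statement covers it.
-/
lemma ker_mkLinearMap_away :
    LinearMap.ker (LocalizedModule.mkLinearMap (Submonoid.powers a) N) =
      powTorsion (Ideal.span {a}) N := by
  ext n
  change LocalizedModule.mkLinearMap (Submonoid.powers a) N n = 0 ↔
    Ideal.span {a} ≤ (Ideal.torsionOf R N n).radical
  rw [Ideal.span_singleton_le_iff_mem, IsLocalizedModule.eq_zero_iff (Submonoid.powers a)]
  constructor
  · rintro ⟨⟨_, b, rfl⟩, hb⟩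
    exact ⟨b, hb⟩
  · rintro ⟨b, hb⟩
    exact ⟨⟨_, b, rfl⟩, hb⟩

/-- Modulo N, the fraction n/a^t is killed by a^t. Thus passing to N_a/N moves the generator `a`
into the torsion ideal. -/
lemma isPowTorsion_awayQuot {K : Ideal R} (h : IsPowTorsion K N) :
    IsPowTorsion (K ⊔ Ideal.span {a}) (AwayQuot a N) := by
  refine IsPowTorsion.sup (fun q r hr => ?_) (isPowTorsion_span_singleton fun q => ?_)
  · obtain ⟨t, n, rfl⟩ := awayDiv_surjective a N q
    obtain ⟨k, hk⟩ := h n hr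
    refine ⟨k, ?_⟩
    exact (map_smul (awayDiv a N t) _ n).symm.trans
      ((congrArg (awayDiv a N t) hk).trans (map_zero _))
  · obtain ⟨t, n, rfl⟩ := awayDiv_surjective a N q
    exact ⟨t, by rw [← map_smul, awayDiv_self]⟩

variable {a N}

/-- A fraction with denominator (u_1⋯u_j)^t over N_a/N, with a = u_0, is a fraction with denominator
(u_0⋯u_j)^t over N. The work lies in clearing the powers of u_0 from a relation in N_a/N. -/
lemma IsTopCech.of_awayQuot {j : ℕ} {u : Fin (j + 1) → R} {H : Type*} [AddCommGroup H]
    [Module R H] (h : IsTopCech (fun i : Fin j => u i.succ) (AwayQuot (u 0) N) H) :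
    IsTopCech u N H := by
  obtain ⟨g, h1, h2, h3⟩ := h
  set v : Fin j → R := fun i => u i.succ with hv
  have hprod : ∏ i, u i = u 0 * ∏ i, v i := Fin.prod_univ_succ u
  refine ⟨fun t => g t ∘ₗ awayDiv (u 0) N t, fun t k n => ?_, fun y => ?_, fun t n => ?_⟩
  · rw [LinearMap.comp_apply, LinearMap.comp_apply, hprod, mul_pow, mul_comm, mul_smul, map_smul,
      awayDiv_add, h1]
  · obtain ⟨t, q, rfl⟩ := h2 y
    obtain ⟨b, n, rfl⟩ := awayDiv_surjective _ _ q
    refine ⟨t + b, (u 0 ^ t * (∏ i, v i) ^ b) • n, ?_⟩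
    rw [LinearMap.comp_apply, mul_comm, mul_smul, map_smul, add_comm t b, awayDiv_add,
      add_comm b t, h1]
  · rw [LinearMap.comp_apply, h3]
    constructor
    · rintro ⟨k, c, hc⟩
      choose b m hm using fun i => awayDiv_surjective _ _ (c i)
      -- A common denominator u_0^B for all the coefficients c_i.
      let B := Finset.univ.sup b
      have hB : ∀ i, awayDiv (u 0) N B (u 0 ^ (B - b i) • m i) = c i := fun i => by
        have hle : b i ≤ B := Finset.le_sup (Finset.mem_univ i)
        conv_lhs => rw [← Nat.add_sub_cancel' hle, Nat.add_sub_cancel_left]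
        rw [awayDiv_add, hm]
      have h0 : awayDiv (u 0) N (t + B) ((u 0 ^ B * (∏ i, v i) ^ k) • n -
          ∑ i, (v i ^ (t + k) * u 0 ^ t) • u 0 ^ (B - b i) • m i) = 0 := by
        rw [map_sub, mul_comm, mul_smul, map_smul, awayDiv_add, hc, map_sum, sub_eq_zero]
        refine Finset.sum_congr rfl fun i _ => ?_
        rw [mul_smul, map_smul, add_comm t B, awayDiv_add, hB]
      obtain ⟨d, m₀, hd⟩ := awayDiv_eq_zero _ _ h0
      have hdvd : ∀ i, ∃ e, v i ^ (B + d) * e = (∏ i, v i) ^ (B + d) := fun i => by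
        obtain ⟨e, he⟩ := pow_dvd_pow_of_dvd (Finset.dvd_prod_of_mem v (Finset.mem_univ i)) (B + d)
        exact ⟨e, he.symm⟩
      choose e he using hdvd
      -- Multiplying the relation `hd` by u_0^k (∏ v_i)^{B+d} brings every variable on the left to
      -- the same exponent k + B + d.
      refine ⟨k + (B + d), Fin.cons ((∏ i, v i) ^ (B + d) • m₀)
        (fun i => (u 0 ^ k * u 0 ^ d * u 0 ^ t * e i * u 0 ^ (B - b i)) • m i), ?_⟩
      have h4 := congrArg (fun x => (u 0 ^ k * (∏ i, v i) ^ (B + d)) • x) hd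
      simp only [smul_sub, Finset.smul_sum, smul_smul] at h4
      rw [sub_eq_iff_eq_add] at h4
      rw [Fin.sum_univ_succ, hprod]
      simp only [Fin.cons_zero, Fin.cons_succ, smul_smul]
      convert h4 using 2
      · ring
      · congr 1; ring
      · refine Finset.sum_congr rfl fun i _ => ?_
        rw [← he i]
        congr 1
        change v i ^ _ * _ = _
        ring
    · rintro ⟨k, c, hc⟩
      refine ⟨k, fun i => awayDiv (u 0) N (t + k) (c i.succ), ?_⟩
      rw [← awayDiv_add _ _ t k, ← map_smul, smul_smul, mul_comm, ← mul_pow, ← hprod, hc,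
        Fin.sum_univ_succ, map_add, awayDiv_self, zero_add, map_sum]
      exact Finset.sum_congr rfl fun i _ => map_smul _ _ _

variable [IsNoetherianRing R] (J : Ideal R)

/-- Local cohomology with respect to `j` elements vanishes in degrees above `j`, and in degree `j`
it is the top Čech cohomology. The module is only required to be torsion with respect to an ideal
which together with the `j` elements generates `J`. -/
theorem LimExt.top_of_isPowTorsion (j : ℕ) (K : Ideal R) (u : Fin j → R)
    (hu : K ⊔ Ideal.span (Set.range u) = J) (N : Type u) [AddCommGroup N] [Module R N]
    (hN : IsPowTorsion K N) :
    (∀ i, j < i → Subsingleton (LimExt J i (ModuleCat.of R N))) ∧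
      IsTopCech u N (LimExt J j (ModuleCat.of R N)) := by
  induction j generalizing K N with
  | zero =>
    obtain rfl : K = J := by
      rw [← hu, Set.range_eq_empty, Ideal.span_empty, sup_bot_eq]
    constructor
    · intro i hi
      obtain ⟨i, rfl⟩ := Nat.exists_eq_succ_of_ne_zero hi.ne'
      exact LimExt.subsingleton_of_isPowTorsion K i N hN
    · refine isTopCech_zero u (LinearEquiv.ofBijective (LimExt.eval K (ModuleCat.of R N))
        ⟨LimExt.eval_injective K, fun n => ?_⟩).symm
      obtain ⟨t, ht⟩ := hN.exists_pow n
      exact LimExt.mem_range_eval K (M := ModuleCat.of R N) ht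
  | succ j ih =>
    have hK : (K ⊔ Ideal.span {u 0}) ⊔ Ideal.span (Set.range fun i : Fin j => u i.succ) = J := by
      rw [← hu, sup_assoc, ← Ideal.span_union]
      congr 2
      rw [Fin.range_fin_succ, Set.singleton_union]
      rfl
    have hu0 : u 0 ∈ J := by
      rw [← hu]
      exact Ideal.mem_sup_right (Ideal.subset_span ⟨0, rfl⟩)
    -- Split N → N_a → N_a/N into 0 → T → N → im → 0 and 0 → im → N_a → N_a/N → 0. Above degree j
    -- the cohomology of T vanishes by induction, and N_a has none since u_0 ∈ J acts bijectively,
    -- so H^i(N_a/N) ≅ H^{i+1}(N) for i ≥ j.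
    let T := LinearMap.ker (LocalizedModule.mkLinearMap (Submonoid.powers (u 0)) N)
    have hT : IsPowTorsion (K ⊔ Ideal.span {u 0}) T := by
      refine (hN.of_injective T.subtype T.subtype_injective).sup ?_
      have := isPowTorsion_powTorsion (K := Ideal.span {u 0}) N
      rwa [← ker_mkLinearMap_away] at this
    obtain ⟨hT', -⟩ := ih _ _ hK T hT
    obtain ⟨hQ', hQ⟩ := ih _ _ hK _ (isPowTorsion_awayQuot (u 0) N hN)
    have hS₁ := shortExact_of_linearMap T.subtype
      (LocalizedModule.mkLinearMap (Submonoid.powers (u 0)) N).rangeRestrict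
      T.subtype_injective (LinearMap.surjective_rangeRestrict _)
      (by
        rw [LinearMap.exact_iff, LinearMap.ker_rangeRestrict, Submodule.range_subtype])
    have hS₂ := shortExact_of_linearMap (awayImage (u 0) N).subtype (awayImage (u 0) N).mkQ
      (Submodule.subtype_injective _) (Submodule.mkQ_surjective _)
      (LinearMap.exact_subtype_mkQ _)
    have hloc : ∀ i, Subsingleton (LimExt J i (ModuleCat.of R (AwayModule (u 0) N))) := fun i =>
      LimExt.subsingleton_of_bijective_smul J hu0 (away_smul_bijective (u 0) N)
    have e : ∀ i, j ≤ i → Nonempty (LimExt J i (ModuleCat.of R (AwayQuot (u 0) N)) ≃ₗ[R]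
        LimExt J (i + 1) (ModuleCat.of R N)) := fun i hi => by
      have := hT' (i + 1) (by lia)
      have := hT' (i + 1 + 1) (by lia)
      have := hloc i
      have := hloc (i + 1)
      exact ⟨LinearEquiv.ofBijective _ (LimExt.δ_bijective J hS₂ (rfl : i + 1 = i + 1)) ≪≫ₗ
        (LinearEquiv.ofBijective _ (LimExt.map_bijective J hS₁ (i := i + 1))).symm⟩
    constructor
    · intro i hi
      obtain ⟨i, rfl⟩ := Nat.exists_eq_succ_of_ne_zero (by lia : i ≠ 0)
      have := hQ' i (by lia)
      exact (e i (by lia)).some.symm.toEquiv.subsingleton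
    · exact (hQ.of_equiv (e j le_rfl).some).of_awayQuot

/-- The top local cohomology with respect to the ideal generated by `s` elements. -/
theorem isTopCech_localCohomology {s : ℕ} (u : Fin s → R) (N : Type u) [AddCommGroup N]
    [Module R N] :
    IsTopCech u N ((localCohomology (Ideal.span (Set.range u)) s).obj (ModuleCat.of R N)) :=
  -- Every module is torsion for the zero ideal, so the induction may start from K = ⊥.
  (LimExt.top_of_isPowTorsion _ s ⊥ u (bot_sup_eq _) N
    (fun _ => bot_le)).2.of_equiv (limExtEquivLocalCohomology _ _ _)

end TopDegree

end

end TopLocalCohomology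

namespace TopLocalCohomology

noncomputable section

/-! ### The determinant argument in the polynomial ring -/

section LinearAlgebra

open MvPolynomial

variable {A : Type u} [CommRing A] {s : ℕ}

/-- The ideal `(X₁ ^ N, …, Xₛ ^ N)`. -/
def powIdeal (A : Type u) [CommRing A] (s N : ℕ) : Ideal (MvPolynomial (Fin s) A) :=
  Ideal.span (Set.range fun i => X i ^ N)

lemma mem_powIdeal {N : ℕ} {f : MvPolynomial (Fin s) A} :
    f ∈ powIdeal A s N ↔ ∀ e, coeff e f ≠ 0 → ∃ i, N ≤ e i := by
  have h : (Set.range fun i : Fin s => (X i ^ N : MvPolynomial (Fin s) A)) =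
      (fun e => monomial e (1 : A)) '' Set.range fun i => Finsupp.single i N := by
    rw [← Set.range_comp]
    simp [Function.comp_def, X_pow_eq_monomial]
  rw [powIdeal, h, mem_ideal_span_monomial_image]
  refine forall_congr' fun e => ?_
  simp [mem_support_iff]

/-- The exponents of weighted degree `D` with all entries less than `N`, in lexicographic order. -/
abbrev BoxExponent (d : Fin s → ℕ) (N D : ℕ) : Type :=
  {x : Lex (Fin s →₀ ℕ) // (∀ i, ofLex x i < N) ∧ Finsupp.weight d (ofLex x) = D}

instance (d : Fin s → ℕ) (N D : ℕ) : Finite (BoxExponent d N D) := by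
  refine Finite.of_injective (β := Fin s → Fin N) (fun x i => ⟨ofLex x.1 i, x.2.1 i⟩) ?_
  intro x y h
  apply Subtype.ext
  apply ofLex.injective
  ext i
  exact congrArg (fun g => (g i : ℕ)) h

instance (d : Fin s → ℕ) (N D : ℕ) : Fintype (BoxExponent d N D) := Fintype.ofFinite _

/-- The matrix of multiplication by `f` modulo `(X₁ ^ N, …, Xₛ ^ N)`, preceded by division by the
monomial with exponent `α`, in weighted degree `D`. -/
def shiftMulMatrix (d : Fin s → ℕ) (N D : ℕ) (α : Fin s →₀ ℕ) (f : MvPolynomial (Fin s) A) :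
    Matrix (BoxExponent d N D) (BoxExponent d N D) A :=
  Matrix.of fun c c' => coeff (ofLex c'.1) (f * monomial (ofLex c.1 - α) 1)

/-- The product is homogeneous of weight `D`, as α ≤ c makes c - α a true difference. Its terms
outside the box lie in `powIdeal`; the others form the row `c` of the matrix. -/
lemma mul_monomial_sub_sum_mem (d : Fin s → ℕ) (N D : ℕ) {α : Fin s →₀ ℕ}
    {f : MvPolynomial (Fin s) A} (hf : IsWeightedHomogeneous d f (Finsupp.weight d α))
    (c : BoxExponent d N D) (hc : α ≤ ofLex c.1) :
    f * monomial (ofLex c.1 - α) 1 -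
      ∑ c', shiftMulMatrix d N D α f c c' • monomial (ofLex c'.1) (1 : A) ∈ powIdeal A s N := by
  classical
  rw [mem_powIdeal]
  intro e he
  by_contra! hlt
  apply he
  have hhom : IsWeightedHomogeneous d (f * monomial (ofLex c.1 - α) 1) D := by
    have h1 := hf.mul (isWeightedHomogeneous_monomial d (ofLex c.1 - α) (1 : A) rfl)
    rwa [← map_add, add_tsub_cancel_of_le hc, c.2.2] at h1
  rw [coeff_sub, coeff_sum, sub_eq_zero]
  simp only [coeff_smul, coeff_monomial, smul_eq_mul, mul_ite, mul_one, mul_zero]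
  by_cases hD : Finsupp.weight d e = D
  · rw [Finset.sum_eq_single (⟨toLex e, hlt, hD⟩ : BoxExponent d N D)]
    · exact (if_pos rfl).symm
    · intro c' _ hne
      rw [if_neg]
      rintro rfl
      exact hne rfl
    · intro h
      exact absurd (Finset.mem_univ _) h
  · rw [hhom.coeff_eq_zero e hD, Finset.sum_eq_zero]
    intro c' _
    rw [if_neg]
    rintro rfl
    exact hD c'.2.2

/-- If all exponents are at least `α`, the determinant of the matrix multiplies everything into
the ideal generated by `f`. -/
lemma det_shiftMulMatrix_smul_mem (d : Fin s → ℕ) (N D : ℕ) {α : Fin s →₀ ℕ}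
    {f : MvPolynomial (Fin s) A} (hf : IsWeightedHomogeneous d f (Finsupp.weight d α))
    (hα : ∀ c : BoxExponent d N D, α ≤ ofLex c.1) (c : BoxExponent d N D) :
    (shiftMulMatrix d N D α f).det • monomial (ofLex c.1) (1 : A) ∈
      Ideal.span {f} ⊔ powIdeal A s N := by
  set T := shiftMulMatrix d N D α f with hT
  have h1 : ∀ c, ∑ c', T c c' • monomial (ofLex c'.1) (1 : A) ∈
      Ideal.span {f} ⊔ powIdeal A s N := fun c => by
    have h2 := mul_monomial_sub_sum_mem d N D hf c (hα c)
    rw [← Ideal.neg_mem_iff, neg_sub] at h2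
    have h3 := add_mem (Ideal.mem_sup_right (S := Ideal.span {f}) h2)
      (Ideal.mem_sup_left (T := powIdeal A s N)
        (Ideal.mul_mem_right (monomial (ofLex c.1 - α) (1 : A)) _
          (Ideal.mem_span_singleton_self f)))
    rwa [sub_add_cancel] at h3
  -- Cramer's rule, adj(T) T = det(T).
  have h4 : T.det • monomial (ofLex c.1) (1 : A) =
      ∑ c', T.adjugate c c' • ∑ c'', T c' c'' • monomial (ofLex c''.1) (1 : A) := by
    simp only [Finset.smul_sum, smul_smul]
    rw [Finset.sum_comm]
    simp only [← Finset.sum_smul, ← Matrix.mul_apply, Matrix.adjugate_mul]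
    simp [Matrix.one_apply]
  rw [h4]
  refine sum_mem fun c' _ => ?_
  rw [smul_eq_C_mul]
  exact Ideal.mul_mem_left _ _ (h1 c')

/-- If `α` is the leading exponent of `f` over a domain, the matrix has nonzero determinant. -/
lemma det_shiftMulMatrix_ne_zero [IsDomain A] (d : Fin s → ℕ) (N D : ℕ)
    {f : MvPolynomial (Fin s) A} (hf : f ≠ 0)
    (hα : ∀ c : BoxExponent d N D, MonomialOrder.lex.degree f ≤ ofLex c.1) :
    (shiftMulMatrix d N D (MonomialOrder.lex.degree f) f).det ≠ 0 := by
  -- The polynomial f·X^{c-α} has leading exponent c, so row c vanishes beyond c and carries the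
  -- leading coefficient of f at c.
  rw [Matrix.det_of_isLowerTriangular]
  · rw [Finset.prod_ne_zero_iff]
    intro c _
    rw [shiftMulMatrix, Matrix.of_apply, coeff_mul_monomial', if_pos tsub_le_self, mul_one,
      tsub_tsub_cancel_of_le (hα c)]
    exact MonomialOrder.lex.leadingCoeff_ne_zero_iff.2 hf
  · intro c c' hcc'
    have hlt : c.1 < c'.1 := hcc'
    rw [shiftMulMatrix, Matrix.of_apply, coeff_mul_monomial', mul_one]
    split_ifs with hle
    · apply MonomialOrder.coeff_eq_zero_of_lt (m := MonomialOrder.lex)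
      have h1 : ofLex c'.1 - (ofLex c.1 - MonomialOrder.lex.degree f) +
        (ofLex c.1 - MonomialOrder.lex.degree f) = ofLex c'.1 := tsub_add_cancel_of_le hle
      have h2 : MonomialOrder.lex.degree f +
        (ofLex c.1 - MonomialOrder.lex.degree f) = ofLex c.1 := add_tsub_cancel_of_le (hα c)
      apply lt_of_add_lt_add_right (a := toLex (ofLex c.1 - MonomialOrder.lex.degree f))
      change toLex (MonomialOrder.lex.degree f + (ofLex c.1 - MonomialOrder.lex.degree f)) <
        toLex (ofLex c'.1 - (ofLex c.1 - MonomialOrder.lex.degree f) +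
          (ofLex c.1 - MonomialOrder.lex.degree f))
      rw [h1, h2]
      exact hlt
    · rfl

lemma shiftMulMatrix_map {B : Type u} [CommRing B] (φ : A →+* B) (d : Fin s → ℕ) (N D : ℕ)
    (α : Fin s →₀ ℕ) (f : MvPolynomial (Fin s) A) :
    φ.mapMatrix (shiftMulMatrix d N D α f) = shiftMulMatrix d N D α (MvPolynomial.map φ f) := by
  ext c c'
  simp only [RingHom.mapMatrix_apply, Matrix.map_apply, shiftMulMatrix, Matrix.of_apply]
  rw [← coeff_map, map_mul, map_monomial, map_one]

/-- Exponents below `N` in large weighted degree are bounded below. -/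
lemma le_of_boxExponent {d : Fin s → ℕ} (hd : ∀ i, 0 < d i) {t k : ℕ} {b : Fin s →₀ ℕ}
    (c : BoxExponent d (t + k) (Finsupp.weight d (b + Finsupp.equivFunOnFinite.symm fun _ => k)))
    (i : Fin s) : k ≤ ofLex c.1 i + t * ∑ i, d i + 1 := by
  obtain ⟨c, hc, hw⟩ := c
  simp only [Finsupp.weight_apply, smul_eq_mul] at hw
  rw [Finsupp.sum_fintype _ _ (by simp), Finsupp.sum_fintype _ _ (by simp)] at hw
  by_contra! hlt
  have hi : i ∈ Finset.univ := Finset.mem_univ i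
  -- The weight is at least k ∑ d_j while every entry is below t + k, so an entry can fall short of
  -- k only by an amount independent of k.
  have h1 : ∑ j, ofLex c j * d j ≤ ofLex c i * d i + ∑ j ∈ Finset.univ.erase i, (t + k) * d j := by
    rw [← Finset.add_sum_erase _ _ hi]
    gcongr with j
    exact (hc j).le
  have h2 : ∑ j, k * d j ≤ ∑ j, ofLex c j * d j := by
    rw [hw]
    gcongr with j
    simp
  have h12 := h2.trans h1
  rw [← Finset.add_sum_erase Finset.univ (fun j => k * d j) hi] at h12
  simp only [add_mul, Finset.sum_add_distrib, ← Finset.mul_sum] at h12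
  rw [← Finset.add_sum_erase _ _ hi] at hlt
  have h3 : k * d i ≤ ofLex c i * d i + t * ∑ j ∈ Finset.univ.erase i, d j := by
    lia
  have h4 : (ofLex c i + t * ∑ j ∈ Finset.univ.erase i, d j + 1) * d i ≤ k * d i := by
    gcongr
    nlinarith [Nat.zero_le (t * d i)]
  nlinarith [hd i, Nat.zero_le (t * ∑ j ∈ Finset.univ.erase i, d j),
    Nat.mul_le_mul_left (t * ∑ j ∈ Finset.univ.erase i, d j) (hd i)]

/-- If a homogeneous polynomial `f` has a coefficient outside the prime `p`, then some element
outside `p` multiplies a given class of the top Čech cohomology into the submodule generated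
by `f`. -/
lemma exists_smul_monomial_mem {d : Fin s → ℕ} (hd : ∀ i, 0 < d i) {n : ℕ}
    {f : MvPolynomial (Fin s) A} (hf : IsWeightedHomogeneous d f n) {p : Ideal A} [p.IsPrime]
    {m : Fin s →₀ ℕ} (hm : coeff m f ∉ p) (t : ℕ) (b : Fin s →₀ ℕ) :
    ∃ r ∉ p, ∃ k, r • ((∏ i, X i) ^ k * monomial b (1 : A)) ∈
      Ideal.span {f} ⊔ powIdeal A s (t + k) := by
  set φ := Ideal.Quotient.mk p
  have hφf : MvPolynomial.map φ f ≠ 0 := by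
    intro h
    have := congrArg (coeff m) h
    rw [coeff_map, coeff_zero] at this
    exact hm (Ideal.Quotient.eq_zero_iff_mem.1 this)
  -- The leading exponent is taken modulo `p`: larger exponents of `f` have coefficients in `p` and
  -- do not affect the determinant mod `p`.
  set α := MonomialOrder.lex.degree (MvPolynomial.map φ f) with hαdef
  have hαf : coeff α f ≠ 0 := by
    intro h
    apply MonomialOrder.lex.leadingCoeff_ne_zero_iff.2 hφf
    rw [MonomialOrder.leadingCoeff, coeff_map, ← hαdef, h, map_zero]
  have hfα : IsWeightedHomogeneous d f (Finsupp.weight d α) := by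
    rwa [hf hαf]
  -- Large enough for `le_of_boxExponent` to force every exponent of the box to dominate α.
  let k := ∑ i, α i + t * ∑ i, d i + 1 + t
  let w := b + Finsupp.equivFunOnFinite.symm fun _ => k
  let D := Finsupp.weight d w
  have hα : ∀ c : BoxExponent d (t + k) D, α ≤ ofLex c.1 := by
    intro c i
    have h1 := le_of_boxExponent hd c i
    have h2 : α i ≤ ∑ i, α i :=
      Finset.single_le_sum (f := fun i => α i) (fun _ _ => Nat.zero_le _) (Finset.mem_univ i)
    lia
  refine ⟨(shiftMulMatrix d (t + k) D α f).det, fun hmem => ?_, k, ?_⟩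
  · rw [← Ideal.Quotient.eq_zero_iff_mem, RingHom.map_det, shiftMulMatrix_map] at hmem
    exact det_shiftMulMatrix_ne_zero d (t + k) D hφf hα hmem
  · have hw : (∏ i, X i) ^ k * monomial b (1 : A) = monomial w 1 := by
      have : (∏ i, X i : MvPolynomial (Fin s) A) ^ k =
          monomial (Finsupp.equivFunOnFinite.symm fun _ => k) 1 := by
        rw [monomial_eq, Finsupp.prod_fintype _ _ (by simp)]
        simp [Finset.prod_pow]
      rw [this, monomial_mul, mul_one, add_comm]
    rw [hw]
    -- If `w` leaves the box, its monomial is already in `powIdeal`.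
    by_cases hbox : ∀ i, w i < t + k
    · exact det_shiftMulMatrix_smul_mem d (t + k) D hfα hα ⟨toLex w, hbox, rfl⟩
    · push Not at hbox
      obtain ⟨i, hi⟩ := hbox
      apply Ideal.mem_sup_right
      rw [mem_powIdeal]
      intro e he
      rw [coeff_smul, coeff_monomial] at he
      refine ⟨i, ?_⟩
      by_cases hwe : w = e
      · exact hwe ▸ hi
      · rw [if_neg hwe, smul_zero] at he
        exact absurd rfl he

end LinearAlgebra

end

end TopLocalCohomology

namespace TopLocalCohomology

noncomputable section

open MvPolynomial

/-! ### Minimal associated primes and support -/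

section Support

variable {R : Type u} [CommRing R] [IsNoetherianRing R] {M : Type u} [AddCommGroup M] [Module R M]

lemma mem_support_of_mem_associatedPrimes {p : Ideal R} (hp : p ∈ associatedPrimes R M) :
    ∃ h : p.IsPrime, (⟨p, h⟩ : PrimeSpectrum R) ∈ Module.support R M := by
  obtain ⟨h, x, hx⟩ := (Submodule.isAssociatedPrime_iff (N := (⊥ : Submodule R M))).1 hp
  refine ⟨h, Module.mem_support_iff_exists_annihilator.2 ⟨x, fun r hr => ?_⟩⟩
  rw [Submodule.mem_annihilator_span_singleton] at hr
  change r ∈ p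
  rw [hx, Submodule.mem_colon_singleton, hr]
  exact zero_mem _

/-- Some cyclic submodule Rm has its annihilator inside `p`, and a minimal prime over that
annihilator is associated to Rm. -/
lemma exists_associatedPrimes_le {p : PrimeSpectrum R} (hp : p ∈ Module.support R M) :
    ∃ q ∈ associatedPrimes R M, q ≤ p.asIdeal := by
  obtain ⟨m, hm⟩ := Module.mem_support_iff_exists_annihilator.1 hp
  obtain ⟨q, hq, hqp⟩ := Ideal.exists_minimalPrimes_le hm
  exact ⟨q, associatedPrimes.subset_of_injective (Submodule.subtype_injective _)
    (Module.associatedPrimes.minimalPrimes_annihilator_subset_associatedPrimes R _ hq), hqp⟩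

/-- If the support of a module over a Noetherian ring is `V(a)`, its minimal associated primes
are the minimal primes of `a`. -/
lemma minimalAssociatedPrimes_eq {a : Ideal R}
    (h : Module.support R M = PrimeSpectrum.zeroLocus (a : Set R)) :
    minimalAssociatedPrimes R M = a.minimalPrimes := by
  have h1 : ∀ p ∈ associatedPrimes R M, p.IsPrime ∧ a ≤ p := fun p hp => by
    obtain ⟨hp', hs⟩ := mem_support_of_mem_associatedPrimes hp
    rw [h] at hs
    exact ⟨hp', hs⟩
  have h2 : ∀ p : Ideal R, p.IsPrime ∧ a ≤ p → ∃ q ∈ associatedPrimes R M, q ≤ p := by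
    rintro p ⟨hp, hap⟩
    have : (⟨p, hp⟩ : PrimeSpectrum R) ∈ Module.support R M := by
      rw [h]
      exact hap
    exact exists_associatedPrimes_le this
  ext p
  constructor
  · intro hp
    refine ⟨h1 p hp.1, fun q hq hqp => ?_⟩
    obtain ⟨q', hq', hle⟩ := h2 q hq
    exact (hp.2 hq' (hle.trans hqp)).trans hle
  · intro hp
    obtain ⟨q, hq, hqp⟩ := h2 p hp.1
    obtain rfl : q = p := le_antisymm hqp (hp.2 (h1 q hq) hqp)
    exact ⟨hq, fun q' hq' hle => hp.2 (h1 q' hq') hle⟩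

end Support

/-! ### Content, annihilators and the support of the top local cohomology -/

variable {R₀ : Type u} [CommRing R₀] {s : ℕ} {d : Fin s → ℕ}
  {I : Ideal (MvPolynomial (Fin s) R₀)}

/-- The classes of the variables generate `R₊`. -/
lemma irrelevantIdeal_eq (hd : ∀ i, 0 < d i) :
    irrelevantIdeal d I = Ideal.span (Set.range fun i => Ideal.Quotient.mk I (X i)) := by
  apply le_antisymm
  · rw [irrelevantIdeal, Ideal.span_le]
    rintro _ ⟨n, hn, f, hf, rfl⟩
    have h1 : f ∈ Ideal.span (X '' (Set.univ : Set (Fin s))) := by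
      rw [mem_ideal_span_X_image]
      intro m hm
      by_contra! h
      have hm0 : m = 0 := by
        ext i
        exact h i trivial
      have := hf (mem_support_iff.1 hm)
      rw [hm0, map_zero] at this
      exact hn.ne this
    have h2 := Ideal.mem_map_of_mem (Ideal.Quotient.mk I) h1
    rwa [Ideal.map_span, Set.image_univ, ← Set.range_comp] at h2
  · rw [Ideal.span_le]
    rintro _ ⟨i, rfl⟩
    exact Ideal.subset_span ⟨d i, hd i, X i, isWeightedHomogeneous_X R₀ d i, rfl⟩

lemma coeff_mem_content {f : MvPolynomial (Fin s) R₀} (hf : f ∈ I) (m : Fin s →₀ ℕ) :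
    coeff m f ∈ content I :=
  (le_iSup₂_of_le (f := fun f (_ : f ∈ I) => polyContent f) f hf le_rfl)
    (Ideal.subset_span ⟨m, rfl⟩)

lemma content_le_iff {p : Ideal R₀} : content I ≤ p ↔ ∀ f ∈ I, ∀ m, coeff m f ∈ p := by
  refine ⟨fun h f hf m => h (coeff_mem_content hf m), fun h => ?_⟩
  refine iSup₂_le fun f hf => ?_
  rw [polyContent, Ideal.span_le]
  rintro _ ⟨m, rfl⟩
  exact h f hf m

lemma quotient_mem_irrelevantIdeal (hd : ∀ i, 0 < d i) (f : MvPolynomial (Fin s) R₀) :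
    Ideal.Quotient.mk I f - algebraMap R₀ _ (coeff 0 f) ∈ irrelevantIdeal d I := by
  have h1 : f - C (coeff 0 f) ∈ Ideal.span (X '' (Set.univ : Set (Fin s))) := by
    classical
    rw [mem_ideal_span_X_image]
    intro m hm
    by_contra! h
    have hm0 : m = 0 := by
      ext i
      exact h i trivial
    rw [mem_support_iff, hm0] at hm
    simp at hm
  have h2 := Ideal.mem_map_of_mem (Ideal.Quotient.mk I) h1
  rw [Ideal.map_span, Set.image_univ, ← Set.range_comp, map_sub] at h2
  rw [irrelevantIdeal_eq hd]
  exact h2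

/-- The element `1 / (u₁ ⋯ uₛ)` is killed only by elements of `𝔠(I)R + R₊`. -/
lemma mem_contentPlusIrrelevant (hd : ∀ i, 0 < d i) {k : ℕ} {r : MvPolynomial (Fin s) R₀ ⧸ I}
    {c : Fin s → MvPolynomial (Fin s) R₀ ⧸ I}
    (h : (∏ i, Ideal.Quotient.mk I (X i)) ^ k * r =
      ∑ i, Ideal.Quotient.mk I (X i) ^ (1 + k) * c i) :
    r ∈ contentPlusIrrelevant d I := by
  obtain ⟨F, rfl⟩ := Ideal.Quotient.mk_surjective r
  choose G hG using fun i => Ideal.Quotient.mk_surjective (c i)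
  obtain rfl : (fun i => Ideal.Quotient.mk I (G i)) = c := funext hG
  simp only [← map_pow, ← map_mul, ← map_prod, ← map_sum] at h
  rw [Ideal.Quotient.eq] at h
  -- At the exponent (k, …, k) the terms X_i^{1+k} G_i contribute nothing, and only the constant
  -- term of `F` remains.
  have hc := coeff_mem_content h (Finsupp.equivFunOnFinite.symm fun _ => k)
  have h1 : (∏ i, X i : MvPolynomial (Fin s) R₀) ^ k =
      monomial (Finsupp.equivFunOnFinite.symm fun _ => k) 1 := by
    rw [monomial_eq, Finsupp.prod_fintype _ _ (by simp)]
    simp [Finset.prod_pow]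
  have h2 : ∀ i, coeff (Finsupp.equivFunOnFinite.symm fun _ => k) (X i ^ (1 + k) * G i) = 0 := by
    intro i
    rw [X_pow_eq_monomial, coeff_monomial_mul', if_neg]
    intro hle
    have := hle i
    simp at this
  rw [coeff_sub, coeff_sum, Finset.sum_eq_zero (fun i _ => h2 i), sub_zero, h1,
    coeff_monomial_mul', if_pos le_rfl, one_mul, tsub_self] at hc
  have h3 := add_mem (Ideal.mem_sup_right (S := (content I).map (algebraMap R₀ _))
    (quotient_mem_irrelevantIdeal (I := I) hd F))
    (Ideal.mem_sup_left (T := irrelevantIdeal d I) (Ideal.mem_map_of_mem _ hc))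
  rwa [sub_add_cancel] at h3

/-- The vanishing criterion in the top Čech cohomology at a prime not containing the content. -/
lemma exists_smul_eq_sum (hd : ∀ i, 0 < d i)
    (hI : I.IsHomogeneous (weightedHomogeneousSubmodule R₀ d)) {p : Ideal R₀} [p.IsPrime]
    (hp : ¬ content I ≤ p) (t : ℕ) (b : Fin s →₀ ℕ) :
    ∃ r ∉ p, ∃ (k : ℕ) (c : Fin s → MvPolynomial (Fin s) R₀ ⧸ I),
      (∏ i, Ideal.Quotient.mk I (X i)) ^ k • algebraMap R₀ (MvPolynomial (Fin s) R₀ ⧸ I) r *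
        Ideal.Quotient.mk I (monomial b 1) = ∑ i, Ideal.Quotient.mk I (X i) ^ (t + k) • c i := by
  rw [content_le_iff] at hp
  push Not at hp
  obtain ⟨f, hf, m, hm⟩ := hp
  -- Homogeneity of `I` allows replacing `f` by its component of the weight of `m`, which keeps the
  -- coefficient outside `p`.
  have hfm := weightedHomogeneousComponent_mem_of_mem R₀ d hI hf (Finsupp.weight d m)
  have hcm : coeff m (weightedHomogeneousComponent d (Finsupp.weight d m) f) ∉ p := by
    rwa [coeff_weightedHomogeneousComponent, if_pos rfl]
  obtain ⟨r, hr, k, hk⟩ := exists_smul_monomial_mem hd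
    (weightedHomogeneousComponent_isWeightedHomogeneous (Finsupp.weight d m) f) hcm t b
  refine ⟨r, hr, k, ?_⟩
  have h1 := Ideal.mem_map_of_mem (Ideal.Quotient.mk I) hk
  have h0 : Ideal.map (Ideal.Quotient.mk I)
      (Ideal.span {weightedHomogeneousComponent d (Finsupp.weight d m) f}) = ⊥ := by
    rw [Ideal.map_span, Set.image_singleton, Ideal.Quotient.eq_zero_iff_mem.2 hfm,
      Ideal.span_singleton_eq_bot]
  rw [Ideal.map_sup, h0, bot_sup_eq, powIdeal, Ideal.map_span, ← Set.range_comp,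
    Ideal.mem_span_range_iff_exists_fun] at h1
  obtain ⟨c, hc⟩ := h1
  refine ⟨c, ?_⟩
  simp only [Function.comp_apply, map_pow] at hc
  simp only [smul_eq_mul]
  rw [Finset.sum_congr rfl (fun i _ => mul_comm _ (c i)), hc, smul_eq_C_mul, map_mul, map_mul,
    map_pow, map_prod]
  change _ * Ideal.Quotient.mk I (C r) * _ = _
  ring

variable [IsNoetherianRing R₀]

theorem support_topLocalCohomology (hd : ∀ i, 0 < d i)
    (hI : I.IsHomogeneous (weightedHomogeneousSubmodule R₀ d)) :
    Module.support (MvPolynomial (Fin s) R₀ ⧸ I) (topLocalCohomology d I) =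
      PrimeSpectrum.zeroLocus
        (contentPlusIrrelevant d I : Set (MvPolynomial (Fin s) R₀ ⧸ I)) := by
  have hcech := isTopCech_localCohomology (fun i => Ideal.Quotient.mk I (X i))
    (MvPolynomial (Fin s) R₀ ⧸ I)
  rw [← irrelevantIdeal_eq hd] at hcech
  obtain ⟨g, -, h2, h3⟩ := hcech
  ext P
  rw [PrimeSpectrum.mem_zeroLocus, SetLike.coe_subset_coe, Module.mem_support_iff_exists_annihilator]
  constructor
  · rintro ⟨y, hy⟩
    obtain ⟨t, x, rfl⟩ := h2 y
    refine sup_le (Ideal.map_le_iff_le_comap.2 ?_) ?_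
    · by_contra hcon
      -- Each monomial has its own multiplier outside the prime P ∩ R₀; for a sum, the product of
      -- the multipliers works.
      have key : ∀ F : MvPolynomial (Fin s) R₀, ∃ r ∉ P.asIdeal.comap (algebraMap R₀ _),
          g t (algebraMap R₀ _ r * Ideal.Quotient.mk I F) = 0 := by
        intro F
        induction F using MvPolynomial.induction_on' with
        | monomial b a =>
          obtain ⟨r, hr, k, c, hc⟩ := exists_smul_eq_sum hd hI hcon t b
          refine ⟨r, hr, ?_⟩
          have hb : monomial b a = C a * monomial b (1 : R₀) := by rw [C_mul_monomial, mul_one]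
          have h0 := (h3 t (algebraMap R₀ _ r * Ideal.Quotient.mk I (monomial b 1))).2
            ⟨k, c, by rw [← hc]; simp only [smul_eq_mul]; ring⟩
          rw [hb, map_mul (Ideal.Quotient.mk I), mul_left_comm,
            ← smul_eq_mul (Ideal.Quotient.mk I (C a)), map_smul, h0, smul_zero]
        | add F G hF hG =>
          obtain ⟨r, hr, hF⟩ := hF
          obtain ⟨r', hr', hG⟩ := hG
          refine ⟨r * r', fun h => ?_, ?_⟩
          · exact (Ideal.IsPrime.mem_or_mem inferInstance h).elim hr hr'
          · have e : algebraMap R₀ (MvPolynomial (Fin s) R₀ ⧸ I) (r * r') *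
                Ideal.Quotient.mk I (F + G) =
                algebraMap R₀ (MvPolynomial (Fin s) R₀ ⧸ I) r' •
                  (algebraMap R₀ _ r * Ideal.Quotient.mk I F) +
                algebraMap R₀ (MvPolynomial (Fin s) R₀ ⧸ I) r •
                  (algebraMap R₀ _ r' * Ideal.Quotient.mk I G) := by
              simp only [smul_eq_mul, map_mul, map_add]
              ring
            rw [e, map_add, map_smul, map_smul, hF, hG, smul_zero, smul_zero, add_zero]
      obtain ⟨F, rfl⟩ := Ideal.Quotient.mk_surjective x
      obtain ⟨r, hr, h0⟩ := key F
      refine hr (hy ?_)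
      rw [Submodule.mem_annihilator_span_singleton, ← map_smul]
      exact h0
    · rw [irrelevantIdeal_eq hd, Ideal.span_le]
      rintro _ ⟨i, rfl⟩
      apply P.isPrime.mem_of_pow_mem t
      apply hy
      rw [Submodule.mem_annihilator_span_singleton, ← map_smul, h3]
      refine ⟨0, Pi.single i x, ?_⟩
      rw [pow_zero, one_smul, add_zero, Finset.sum_eq_single i]
      · rw [Pi.single_eq_same]
      · intro j _ hj
        rw [Pi.single_eq_of_ne hj, smul_zero]
      · intro h
        exact absurd (Finset.mem_univ i) h
  · intro hP
    -- The witness is 1/(u_1⋯u_s).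
    refine ⟨g 1 1, fun r hr => hP ?_⟩
    rw [Submodule.mem_annihilator_span_singleton, ← map_smul, h3] at hr
    obtain ⟨k, c, hc⟩ := hr
    simp only [smul_eq_mul, mul_one] at hc
    exact mem_contentPlusIrrelevant hd hc

end

end TopLocalCohomology
theorem mainTheorem3 {R₀ : Type u} [CommRing R₀] [IsDomain R₀] [IsNoetherianRing R₀]
    {s : ℕ} (d : Fin s → ℕ) (hd : ∀ i, 0 < d i)
    (I : Ideal (MvPolynomial (Fin s) R₀))
    (hI : I.IsHomogeneous (MvPolynomial.weightedHomogeneousSubmodule R₀ d)) :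
    (TopLocalCohomology.minimalAssociatedPrimes (MvPolynomial (Fin s) R₀ ⧸ I)
      (TopLocalCohomology.topLocalCohomology d I)).Finite ∧
    TopLocalCohomology.minimalAssociatedPrimes (MvPolynomial (Fin s) R₀ ⧸ I)
      (TopLocalCohomology.topLocalCohomology d I) =
        (TopLocalCohomology.contentPlusIrrelevant d I).minimalPrimes ∧
    Module.support (MvPolynomial (Fin s) R₀ ⧸ I) (TopLocalCohomology.topLocalCohomology d I) =
      PrimeSpectrum.zeroLocus
        (TopLocalCohomology.contentPlusIrrelevant d I : Set (MvPolynomial (Fin s) R₀ ⧸ I)) := by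
  have h := TopLocalCohomology.support_topLocalCohomology hd hI
  have h' := TopLocalCohomology.minimalAssociatedPrimes_eq h
  refine ⟨?_, h', h⟩
  rw [h']
  exact Ideal.finite_minimalPrimes_of_isNoetherianRing _ _
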